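/- Let $n\ge 1$, let $\mathcal{K}\subset\mathbb{R}^n$ be compact and convex with $r\mathcal{B}\subseteq\mathcal{K}\subseteq R\mathcal{B}$, where $r,R>0$ and $\mathcal{B}$ is the closed Euclidean unit ball centered at the origin. Let $T\ge 1$ be an integer such that $\sqrt T$ is an integer, and let $f_1,\dots,f_T:\mathbb{R}^n\to\mathbb{R}$ be convex functions, fixed in advance, such that for all $t$ and all $\mathbf{x}\in\mathcal{K}$: $|f_t(\mathbf{x})|\le M$, and $\|\mathbf{g}\|\le G$ for every subgradient $\mathbf{g}\in\partial f_t(\mathbf{x})$ (Euclidean norm; $G,M>0$). **Conditional gradient method with stopping.** Given a set $\mathcal{K}_\delta$, a tolerance $\epsilon$, an initial point $\mathbf{x}_{in}$ and a function $F$: put $\mathbf{z}_1=\mathbf{x}_{in}$; for $\tau=1,2,\dots$ call a linear optimization oracle for $\mathbf{v}_\tau\in\arg\min_{\mathbf{x}\in\mathcal{K}_\delta}\nabla F(\mathbf{z}_\tau)^\top\mathbf{x}$, choose $\sigma_\tau\in\arg\min_{\sigma\in[0,1]}F(\mathbf{z}_\tau+\sigma(\mathbf{v}_\tau-\mathbf{z}_\tau))$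 and put $\mathbf{z}_{\tau+1}=\mathbf{z}_\tau+\sigma_\tau(\mathbf{v}_\tau-\mathbf{z}_\tau)$; stop after the first iteration $\tau$ with $\nabla F(\mathbf{z}_\tau)^\top(\mathbf{z}_\tau-\mathbf{v}_\tau)\le\epsilon$ and return $\mathbf{z}_\tau$. **Block bandit conditional gradient method.** Parameters: block size $K$ (with $K\mid T$), step size $\eta>0$, smoothing parameter $\delta\in(0,r]$, tolerance $\epsilon>0$. Put $\mathcal{K}_\delta=(1-\delta/r)\mathcal{K}$, let $\mathbf{x}_0\in\mathcal{K}_\delta$ be arbitrary and $\mathbf{x}_1=\mathbf{x}_0$. For each block $m=1,\dots,T/K$ and each round $t=(m-1)K+s$, $s=1,\dots,K$, draw $\mathbf{u}_t$ uniformly from the unit sphere, independently of the past, play $\mathbf{y}_t=\mathbf{x}_{m-1}+\delta\mathbf{u}_t$, observe $f_t(\mathbf{y}_t)$, and put $\mathbf{g}_t=\frac n\delta f_t(\mathbf{y}_t)\mathbf{u}_t$; at the end of the block put $\hat{\mathbf{g}}_m=\sum_{s=1}^K\mathbf{g}_{(m-1)K+s}$. In every block $m\ge 2$, the point $\mathbf{x}_m$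 is the output of the conditional gradient method with stopping, run on $\mathcal{K}_\delta$ with tolerance $\epsilon$, initial point $\mathbf{x}_{m-1}$ and $\hat F_m(\mathbf{x})=\eta\sum_{i=1}^{m-1}\mathbf{x}^\top\hat{\mathbf{g}}_i+\|\mathbf{x}-\mathbf{x}_1\|^2$. Let $L_m$ be the number of iterations (equivalently, of calls to the linear optimization oracle) of that run, with $L_1=0$, and let $$\mathbb{E}[\mathcal{R}_T]=\sum_{t=1}^T\mathbb{E}[f_t(\mathbf{y}_t)]-\min_{\mathbf{x}\in\mathcal{K}}\sum_{t=1}^T f_t(\mathbf{x}).$$ **Theorem.** For every $c>0$ with $cT^{-1/4}/r\le 1$, the choice $\eta=\frac{2cR}{nM}T^{-3/4}$, $\delta=cT^{-1/4}$, $\epsilon=16R^2T^{-1/2}$, $K=T^{1/2}$ guarantees $$\mathbb{E}[\mathcal{R}_T]\le\Big(3cG+\frac{cRG}{r}+6GR+4\frac{cG^2R}{nM}+4\frac{RnM}{c}\Big)T^{3/4},$$ $$\mathbb{E}\Big[\sum_{m=1}^{T/K}L_m\Big]\le\Big(\frac34+\frac{Gc}{2nM}+\frac{G^2c^2}{4n^2M^2}\Big)T.$$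 In particular, if $\big(\frac{nM}{Gr}\big)^2\le T$, then with $c=\sqrt{nMr/G}$, $$\mathbb{E}[\mathcal{R}_T]\le\Big(8\frac Rr\sqrt{nMrG}+6GR+4GR\sqrt{\frac{rG}{nM}}\Big)T^{3/4},$$ $$\mathbb{E}\Big[\sum_{m=1}^{T/K}L_m\Big]\le\Big(\frac34+\frac12\sqrt{\frac{Gr}{nM}}+\frac14\sqrt{\frac{Gr}{nM}}\Big)T.$$ -/

import Mathlib

open MeasureTheory ProbabilityTheory
open scoped Pointwise ENNReal

noncomputable section

namespace BlockBandit

/-- `ℝⁿ` with its Euclidean norm and inner product. -/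
abbrev E (n : ℕ) : Type := EuclideanSpace ℝ (Fin n)

/-- The uniform probability distribution on the unit sphere of `ℝⁿ`, as a measure on `ℝⁿ`:
the normalised surface measure of the sphere. -/
def uniformSphere (n : ℕ) : Measure (E n) :=
  (((volume : Measure (E n)).toSphere Set.univ)⁻¹ • (volume : Measure (E n)).toSphere).map
    Subtype.val

/-- The subdifferential `∂f(x)` of a function that is convex on all of `ℝⁿ`. -/
def subdifferential {n : ℕ} (f : E n → ℝ) (x : E n) : Set (E n) :=
  {g | ∀ y, f x + inner ℝ g (y - x) ≤ f y}

/-- The shrunk set `S_δ = (1 - δ/r) S`. -/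
def shrunk {n : ℕ} (S : Set (E n)) (r δ : ℝ) : Set (E n) := (1 - δ / r) • S

/-! ### The conditional gradient method with a stopping condition -/

/-- The test `∇F(z_τ)ᵀ (z_τ - v_τ) ≤ ε` that ends the do-while loop after iteration `τ`. -/
def CGStop {n : ℕ} (F : E n → ℝ) (ε : ℝ) (z v : ℕ → E n) (τ : ℕ) : Prop :=
  inner ℝ (gradient F (z τ)) (z τ - v τ) ≤ ε

/-- Iteration `τ ≥ 1` of the do-while loop is performed: none of the iterations
`1, …, τ - 1` ended the loop. -/
def CGReached {n : ℕ} (F : E n → ℝ) (ε : ℝ) (z v : ℕ → E n) (τ : ℕ) : Prop :=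
  1 ≤ τ ∧ ∀ j, 1 ≤ j → j < τ → ¬ CGStop F ε z v j

/-- The number of iterations of the do-while loop, which is the number of calls to the linear
optimization oracle; it is `⊤` if the loop does not terminate. -/
def cgIterations {n : ℕ} (F : E n → ℝ) (ε : ℝ) (z v : ℕ → E n) : ℕ∞ :=
  ⨅ (τ : ℕ) (_ : 1 ≤ τ ∧ CGStop F ε z v τ), (τ : ℕ∞)

/-- The sequences `z, v` and the point `xout` are produced by the conditional gradient method
with stopping condition, run with feasible set `S`, tolerance `ε`, initial vector `xin` and
objective `F`. Only the iterations that are performed are constrained; any minimizer may be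
returned by the linear optimization oracle. -/
structure IsCGRun {n : ℕ} (S : Set (E n)) (ε : ℝ) (xin : E n) (F : E n → ℝ)
    (z v : ℕ → E n) (xout : E n) : Prop where
  init : z 1 = xin
  oracle : ∀ τ, CGReached F ε z v τ →
    v τ ∈ S ∧ IsMinOn (fun x => (inner ℝ (gradient F (z τ)) x : ℝ)) S (v τ)
  line_search : ∀ τ, CGReached F ε z v τ → ∃ σ ∈ Set.Icc (0 : ℝ) 1,
    IsMinOn (fun s : ℝ => F (z τ + s • (v τ - z τ))) (Set.Icc 0 1) σ ∧
      z (τ + 1) = z τ + σ • (v τ - z τ)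
  output : ∀ τ, CGReached F ε z v τ → CGStop F ε z v τ → xout = z τ

/-! ### The block bandit conditional gradient method

Below, `x m` is the iterate with index `m`, `u t` the random direction of round `t`, and rounds
and blocks are numbered from `1`. Round `t` belongs to block `m(t) = ⌈t/K⌉ = (t - 1)/K + 1`. -/

section Quantities

variable {n : ℕ} {Ω : Type*}

/-- The point `y_t = x_{m(t)-1} + δ u_t` played on round `t ≥ 1`. -/
def play (K : ℕ) (δ : ℝ) (x u : ℕ → Ω → E n) (t : ℕ) (ω : Ω) : E n :=
  x ((t - 1) / K) ω + δ • u t ω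

/-- The one-point gradient estimate `g_t = (n/δ) f_t(y_t) u_t`. -/
def gradEst (K : ℕ) (δ : ℝ) (f : ℕ → E n → ℝ) (x u : ℕ → Ω → E n) (t : ℕ) (ω : Ω) : E n :=
  ((n : ℝ) / δ * f t (play K δ x u t ω)) • u t ω

/-- The gradient estimate `ĝ_m = ∑_{s=1}^{K} g_{(m-1)K+s}` of block `m ≥ 1`. -/
def blockGrad (K : ℕ) (δ : ℝ) (f : ℕ → E n → ℝ) (x u : ℕ → Ω → E n) (m : ℕ) (ω : Ω) : E n :=
  ∑ s ∈ Finset.Icc 1 K, gradEst K δ f x u ((m - 1) * K + s) ω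

/-- The objective `F̂_m(p) = η ∑_{i=1}^{m-1} pᵀ ĝ_i + ‖p - x_1‖²` of block `m ≥ 1`. -/
def objective (K : ℕ) (η δ : ℝ) (f : ℕ → E n → ℝ) (x u : ℕ → Ω → E n) (m : ℕ) (ω : Ω)
    (p : E n) : ℝ :=
  η * ∑ i ∈ Finset.Icc 1 (m - 1), inner ℝ p (blockGrad K δ f x u i ω) + ‖p - x 1 ω‖ ^ 2

end Quantities

/-- A run of the block bandit conditional gradient method on the probability space `(Ω, P)`, with
horizon `T`, feasible set `S` (and inner radius `r`), block size `K`, step size `η`, smoothing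
parameter `δ` and tolerance `ε`, against the fixed losses `f 1, …, f T`.
The σ-algebra `𝓕 t` is the information available after round `t`. Each direction is uniform on
the sphere and independent of the past; the answers of the linear optimization oracle during
block `m` may depend in any (measurable) way on what has happened up to the end of block `m`. -/
structure Run {Ω : Type*} [mΩ : MeasurableSpace Ω] (P : Measure Ω) {n : ℕ}
    (T : ℕ) (S : Set (E n)) (r : ℝ) (K : ℕ) (η δ ε : ℝ) (f : ℕ → E n → ℝ) where
  /-- the information available after each round -/
  𝓕 : Filtration ℕ mΩ
  /-- the random directions -/
  u : ℕ → Ω → E n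
  /-- the iterates -/
  x : ℕ → Ω → E n
  /-- `z m τ` is the iterate `τ` of the conditional gradient method in block `m` -/
  z : ℕ → ℕ → Ω → E n
  /-- `v m τ` is the answer of the oracle on iteration `τ` in block `m` -/
  v : ℕ → ℕ → Ω → E n
  measurable_u : ∀ t ∈ Finset.Icc 1 T, Measurable[𝓕 t] (u t)
  law_u : ∀ t ∈ Finset.Icc 1 T, P.map (u t) = uniformSphere n
  indep_u : ∀ t ∈ Finset.Icc 1 T, Indep (MeasurableSpace.comap (u t) inferInstance) (𝓕 (t - 1)) P
  measurable_x : ∀ m ∈ Finset.Icc 0 (T / K), Measurable[𝓕 (m * K)] (x m)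
  measurable_z : ∀ m ∈ Finset.Icc 2 (T / K), ∀ τ, 1 ≤ τ → Measurable[𝓕 (m * K)] (z m τ)
  measurable_v : ∀ m ∈ Finset.Icc 2 (T / K), ∀ τ, 1 ≤ τ → Measurable[𝓕 (m * K)] (v m τ)
  x_zero_mem : ∀ ω, x 0 ω ∈ shrunk S r δ
  x_one : ∀ ω, x 1 ω = x 0 ω
  cg : ∀ m ∈ Finset.Icc 2 (T / K), ∀ ω,
    IsCGRun (shrunk S r δ) ε (x (m - 1) ω) (objective K η δ f x u m ω)
      (fun τ => z m τ ω) (fun τ => v m τ ω) (x m ω)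

namespace Run

variable {Ω : Type*} [MeasurableSpace Ω] {P : Measure Ω} {n T : ℕ} {S : Set (E n)} {r : ℝ}
  {K : ℕ} {η δ ε : ℝ} {f : ℕ → E n → ℝ}

/-- The point `y_t` played on round `t`. -/
def y (A : Run P T S r K η δ ε f) (t : ℕ) (ω : Ω) : E n := play K δ A.x A.u t ω

/-- The expected regret `∑_{t=1}^{T} 𝔼[f_t(y_t)] - min_{p ∈ S} ∑_{t=1}^{T} f_t(p)`. -/
def expectedRegret (A : Run P T S r K η δ ε f) : ℝ :=
  (∑ t ∈ Finset.Icc 1 T, ∫ ω, f t (A.y t ω) ∂P)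
    - sInf ((fun p => ∑ t ∈ Finset.Icc 1 T, f t p) '' S)

/-- The number `L_m` of oracle calls in block `m`; the conditional gradient method is not
invoked in block `1`. -/
def oracleCalls (A : Run P T S r K η δ ε f) (m : ℕ) (ω : Ω) : ℕ∞ :=
  if 1 < m then
    cgIterations (objective K η δ f A.x A.u m ω) ε (fun τ => A.z m τ ω) (fun τ => A.v m τ ω)
  else 0

/-- The expected overall number `𝔼[∑_{m=1}^{T/K} L_m]` of oracle calls. -/
def expectedOracleCalls (A : Run P T S r K η δ ε f) : ℝ≥0∞ :=
  ∫⁻ ω, ((∑ m ∈ Finset.Icc 1 (T / K), A.oracleCalls m ω : ℕ∞) : ℝ≥0∞) ∂P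

end Run

end BlockBandit

end

namespace BlockBandit

open Filter Topology Set

/-! Given the past, the estimate `g_t` has mean `sphereGrad (f t) δ x`, where `x` is the centre of
the block. Two facts about this vector suffice: its norm is at most `G`, and it is a subgradient of
the loss up to an error `2δG`. Both come from `integral_uniformSphere_mul_inner_le`, a divergence
theorem on the ball for Lipschitz functions, so the gradient of a smoothed loss never has to be
formed.

Regret. Let `p_m` be the exact minimizer of the regularised linear objective over the shrunk set. It
depends on earlier blocks only, so the linear regret of `p_m` against the estimates (`ftrl_regret`)
passes to the losses in expectation. The centre `x_{m-1}` is within `√ε` of `p_{m-1}`, and `p_m` is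
within `(η/2)‖ĝ_{m-1}‖` of `p_{m-1}`. All rounds of a block share one centre, so cross terms of
`‖ĝ_m‖²` have mean at most `G²`, and its mean is at most `K(nM/δ)² + K²G²` instead of `K²(nM/δ)²`
(`integral_sq_norm_block_le`).

Oracle calls. Each iteration but the last of a run lowers the objective by at least `16R²/K²`, so
the calls are paid for by the total decrease over all runs, which telescopes (`ftrl_progress_le`).
Independently, no run exceeds `2K` iterations, so there are never more than `2T` calls. -/

/-! ### Integration by parts on the ball and the uniform measure on the sphere. -/

theorem integral_polar {n : ℕ} (hn : 1 ≤ n) {g : E n → ℝ} (hg : Integrable g) :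
    ∫ v, g v = ∫ t in Ioi (0 : ℝ), t ^ (n - 1) *
      ∫ w, g (t • (w : E n)) ∂(volume : Measure (E n)).toSphere := by
  have : Nontrivial (E n) := Module.nontrivial_of_finrank_pos (R := ℝ) (by simp; omega)
  let μ : Measure (E n) := volume
  have hmp := μ.measurePreserving_homeomorphUnitSphereProd
  have hemb := (homeomorphUnitSphereProd (E n)).measurableEmbedding
  let G : (Metric.sphere (0 : E n) 1) × (Ioi (0 : ℝ)) → ℝ := fun q => g (q.2.1 • (q.1 : E n))
  have hG : ∀ x : ({(0 : E n)}ᶜ : Set (E n)), G (homeomorphUnitSphereProd (E n) x) = g x := by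
    intro x
    simp only [G, homeomorphUnitSphereProd_apply_snd_coe, homeomorphUnitSphereProd_apply_fst_coe]
    rw [smul_smul, mul_inv_cancel₀ (norm_ne_zero_iff.2 x.2), one_smul]
  have hGi : Integrable G (μ.toSphere.prod (.volumeIoiPow (n - 1))) := by
    have h1 := hmp.integrable_comp_emb (g := G) hemb
    simp only [finrank_euclideanSpace, Fintype.card_fin] at h1
    rw [← h1]
    have h2 : IntegrableOn g ({0}ᶜ) μ := hg.integrableOn
    rw [integrableOn_iff_comap_subtypeVal (by measurability)] at h2
    convert h2 using 1
    ext x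
    exact hG x
  calc ∫ v, g v ∂μ = ∫ x : ({(0 : E n)}ᶜ : Set (E n)), g x ∂(μ.comap (↑)) := by
        rw [integral_subtype_comap (measurableSet_singleton _).compl, restrict_compl_singleton]
    _ = ∫ x, G x ∂μ.toSphere.prod (.volumeIoiPow (n - 1)) := by
        have := hmp.integral_comp hemb G
        simp only [finrank_euclideanSpace, Fintype.card_fin] at this
        rw [← this]
        exact integral_congr_ae (.of_forall fun x => (hG x).symm)
    _ = ∫ t : Ioi (0 : ℝ), ∫ w, g (t.1 • (w : E n)) ∂μ.toSphere ∂(.volumeIoiPow (n - 1)) :=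
        integral_prod_symm _ hGi
    _ = _ := by
        simp only [Measure.volumeIoiPow, ENNReal.ofReal]
        rw [integral_withDensity_eq_integral_smul
          ((measurable_subtype_coe.pow_const _).real_toNNReal),
          integral_subtype_comap measurableSet_Ioi fun a : ℝ ↦ Real.toNNReal (a ^ (n - 1)) •
            ∫ w, g (a • (w : E n)) ∂μ.toSphere]
        refine setIntegral_congr_fun measurableSet_Ioi fun x hx ↦ ?_
        simp only [NNReal.smul_def, smul_eq_mul]
        rw [Real.coe_toNNReal _ (pow_nonneg (le_of_lt hx) _)]

/-- The piecewise linear radial cutoff that is `1` on the ball of radius `1 - h` and `0` outside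
the unit ball. -/
noncomputable def radialCutoff {n : ℕ} (h : ℝ) (v : E n) : ℝ := min 1 (max 0 ((1 - ‖v‖) / h))

theorem radialCutoff_lipschitz {n : ℕ} {h : ℝ} (hh : 0 < h) :
    LipschitzWith (Real.toNNReal h⁻¹) (radialCutoff h : E n → ℝ) := by
  have h1 : LipschitzWith (Real.toNNReal h⁻¹) (fun v : E n => (1 - ‖v‖) / h) := by
    refine LipschitzWith.of_dist_le_mul fun v w => ?_
    rw [Real.coe_toNNReal _ (by positivity), Real.dist_eq, dist_eq_norm]
    have : (1 - ‖v‖) / h - (1 - ‖w‖) / h = h⁻¹ * (‖w‖ - ‖v‖) := by field_simp; ring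
    rw [this, abs_mul, abs_of_pos (inv_pos.2 hh)]
    gcongr
    rw [abs_sub_comm]
    exact abs_norm_sub_norm_le v w
  exact (h1.const_max 0).const_min 1

theorem radialCutoff_mem_Icc {n : ℕ} (h : ℝ) (v : E n) : radialCutoff h v ∈ Icc (0 : ℝ) 1 :=
  ⟨le_min zero_le_one (le_max_left _ _), min_le_left _ _⟩

theorem radialCutoff_eq_zero {n : ℕ} {h : ℝ} (hh : 0 < h) {v : E n} (hv : 1 ≤ ‖v‖) :
    radialCutoff h v = 0 := by
  have : (1 - ‖v‖) / h ≤ 0 := div_nonpos_of_nonpos_of_nonneg (by linarith) hh.le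
  simp [radialCutoff, max_eq_left this]

theorem radialCutoff_eq_one {n : ℕ} {h : ℝ} (hh : 0 < h) {v : E n} (hv : ‖v‖ ≤ 1 - h) :
    radialCutoff h v = 1 := by
  have : 1 ≤ (1 - ‖v‖) / h := by rw [le_div_iff₀ hh]; linarith
  rw [radialCutoff, min_eq_left (le_max_of_le_right this)]

theorem radialCutoff_eq_of_mem {n : ℕ} {h : ℝ} (hh : 0 < h) {v : E n} (hv : 1 - h ≤ ‖v‖)
    (hv' : ‖v‖ ≤ 1) : radialCutoff h v = (1 - ‖v‖) / h := by
  have h1 : (1 - ‖v‖) / h ≤ 1 := by rw [div_le_one hh]; linarith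
  have h2 : 0 ≤ (1 - ‖v‖) / h := div_nonneg (by linarith) hh.le
  rw [radialCutoff, max_eq_right h2, min_eq_right h1]

theorem radialCutoff_hasCompactSupport {n : ℕ} {h : ℝ} (hh : 0 < h) :
    HasCompactSupport (radialCutoff h : E n → ℝ) := by
  refine HasCompactSupport.intro (isCompact_closedBall (0 : E n) 1) fun v hv => ?_
  refine radialCutoff_eq_zero hh ?_
  simp at hv
  exact hv.le

theorem lineDeriv_radialCutoff {n : ℕ} {h : ℝ} (hh : 0 < h) (hh1 : h < 1) {v : E n}
    (hv : ‖v‖ ≠ 1) (hv' : ‖v‖ ≠ 1 - h) (d : E n) :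
    lineDeriv ℝ (radialCutoff h) v (-d) =
      if 1 - h < ‖v‖ ∧ ‖v‖ < 1 then h⁻¹ * (inner ℝ v d / ‖v‖) else 0 := by
  have hc : Continuous (fun w : E n => ‖w‖) := continuous_norm
  by_cases hin : 1 - h < ‖v‖ ∧ ‖v‖ < 1
  · rw [if_pos hin]
    have hev : (radialCutoff h : E n → ℝ) =ᶠ[𝓝 v] fun w => (1 - ‖w‖) / h := by
      filter_upwards [hc.continuousAt.eventually (lt_mem_nhds hin.1),
        hc.continuousAt.eventually (gt_mem_nhds hin.2)] with w h1 h2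
      exact radialCutoff_eq_of_mem hh h1.le h2.le
    rw [hev.lineDeriv_eq]
    have hv0 : v ≠ 0 := by
      rintro rfl
      simp at hin
      linarith
    have hd : HasDerivAt (fun t : ℝ => (1 - ‖v + t • (-d)‖) / h)
        (h⁻¹ * (inner ℝ v d / ‖v‖)) 0 := by
      have h1 : HasDerivAt (fun t : ℝ => v + t • (-d)) (-d) 0 := by
        simpa using ((hasDerivAt_id (0 : ℝ)).smul_const (-d)).const_add v
      have h2 : HasDerivAt (fun t : ℝ => ‖v + t • (-d)‖ ^ 2) (2 * inner ℝ v (-d)) 0 := by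
        simpa using h1.norm_sq
      have h3 := h2.sqrt (by simpa using hv0)
      have h4 : HasDerivAt (fun t : ℝ => (1 - √(‖v + t • (-d)‖ ^ 2)) / h) _ 0 :=
        (h3.const_sub 1).div_const h
      simp only [Real.sqrt_sq (norm_nonneg _)] at h4
      convert h4 using 1
      simp only [zero_smul, add_zero, inner_neg_right]
      have := norm_ne_zero_iff.2 hv0
      field_simp
    exact hd.deriv
  · rw [if_neg hin]
    rcases lt_or_gt_of_ne hv with h1 | h1
    · have h2 : ‖v‖ < 1 - h := lt_of_le_of_ne (not_lt.1 fun h3 => hin ⟨h3, h1⟩) hv'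
      have hev : (radialCutoff h : E n → ℝ) =ᶠ[𝓝 v] fun _ => 1 := by
        filter_upwards [hc.continuousAt.eventually (gt_mem_nhds h2)] with w h1
        exact radialCutoff_eq_one hh h1.le
      rw [hev.lineDeriv_eq]
      simp [lineDeriv]
    · have hev : (radialCutoff h : E n → ℝ) =ᶠ[𝓝 v] fun _ => 0 := by
        filter_upwards [hc.continuousAt.eventually (lt_mem_nhds h1)] with w h1
        exact radialCutoff_eq_zero hh h1.le
      rw [hev.lineDeriv_eq]
      simp [lineDeriv]

/-- Integration by parts moves the derivative onto the cutoff, whose gradient is `-v/(h‖v‖)` on the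
shell `1 - h < ‖v‖ < 1` and zero off its closure. Polar coordinates then turn the shell integral
into an average of integrals over spheres. -/
theorem integral_lineDeriv_mul_radialCutoff {n : ℕ} (hn : 1 ≤ n) {φ : E n → ℝ} {L : NNReal}
    (hφ : LipschitzWith L φ) (d : E n) {h : ℝ} (hh : 0 < h) (hh1 : h < 1) :
    ∫ v, lineDeriv ℝ φ v d * radialCutoff h v =
      h⁻¹ * ∫ t in (1 - h)..1, t ^ (n - 1) *
        ∫ w : Metric.sphere (0 : E n) 1, φ (t • (w : E n)) * inner ℝ (w : E n) d
          ∂(volume : Measure (E n)).toSphere := by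
  have : Nontrivial (E n) := Module.nontrivial_of_finrank_pos (R := ℝ) (by simp; omega)
  rw [hφ.integral_lineDeriv_mul_eq (radialCutoff_lipschitz hh) (radialCutoff_hasCompactSupport hh)]
  let A : Set (E n) := {v | 1 - h < ‖v‖ ∧ ‖v‖ < 1}
  let b : E n → ℝ := fun v => h⁻¹ * (inner ℝ v d / ‖v‖) * φ v
  have hA : MeasurableSet A :=
    (measurableSet_lt measurable_const measurable_norm).inter
      (measurableSet_lt measurable_norm measurable_const)
  have hae : (fun v => lineDeriv ℝ (radialCutoff h) v (-d) * φ v) =ᵐ[volume] A.indicator b := by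
    -- The cutoff has kinks only on two spheres, which are null sets.
    have h1 : ∀ r : ℝ, ∀ᵐ v : E n, ‖v‖ ≠ r := fun r => by
      have := Measure.addHaar_sphere (volume : Measure (E n)) 0 r
      rw [← compl_mem_ae_iff] at this
      filter_upwards [this] with v hv
      simpa using hv
    filter_upwards [h1 1, h1 (1 - h)] with v hv hv'
    rw [lineDeriv_radialCutoff hh hh1 hv hv', indicator_apply]
    simp only [A, b, mem_ofPred_eq]
    split_ifs <;> simp
  have hint : Integrable (A.indicator b) := by
    rw [integrable_indicator_iff hA]
    have hcomp : IsCompact (Metric.closedBall (0 : E n) 1 ∩ {v | 1 - h ≤ ‖v‖}) :=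
      (isCompact_closedBall _ _).inter_right (isClosed_le continuous_const continuous_norm)
    refine IntegrableOn.mono_set (ContinuousOn.integrableOn_compact hcomp ?_) ?_
    · refine ContinuousOn.mul (continuousOn_const.mul (ContinuousOn.div ?_ ?_ ?_))
        hφ.continuous.continuousOn
      · fun_prop
      · fun_prop
      · intro v hv
        have := hv.2
        simp only [mem_ofPred_eq] at this
        linarith
    · intro v hv
      exact ⟨by simpa using hv.2.le, hv.1.le⟩
  rw [integral_congr_ae hae, integral_polar hn hint, intervalIntegral.integral_of_le (by linarith),
    ← integral_const_mul, ← integral_Ioc_eq_integral_Ioo.symm]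
  have hsub : Ioo (1 - h) 1 ⊆ Ioi 0 := fun t ht => by
    have := ht.1
    simp only [mem_Ioi]
    linarith
  refine (setIntegral_eq_of_subset_of_forall_sdiff_eq_zero measurableSet_Ioi hsub ?_).trans ?_
  rotate_left
  · refine setIntegral_congr_fun measurableSet_Ioo fun t ht => ?_
    have ht0 : 0 < t := hsub ht
    rw [mul_left_comm h⁻¹]
    congr 1
    rw [← integral_const_mul]
    refine integral_congr_ae (.of_forall fun w => ?_)
    simp only
    have hw : ‖(w : E n)‖ = 1 := by simp
    have hmem : t • (w : E n) ∈ A := by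
      simp only [A, mem_ofPred_eq, norm_smul, hw, mul_one, Real.norm_eq_abs, abs_of_pos ht0]
      exact ht
    rw [indicator_of_mem hmem]
    simp only [b, norm_smul, hw, mul_one, Real.norm_eq_abs, abs_of_pos ht0, real_inner_smul_left]
    field_simp
  · intro t ht
    have ht0 : 0 < t := ht.1
    refine mul_eq_zero_of_right _ ?_
    rw [integral_eq_zero_of_ae]
    refine .of_forall fun w => ?_
    have hw : ‖(w : E n)‖ = 1 := by simp
    refine indicator_of_notMem ?_ _
    simp only [A, mem_ofPred_eq, norm_smul, hw, mul_one, Real.norm_eq_abs, abs_of_pos ht0]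
    exact ht.2

theorem continuous_integral_sphere {n : ℕ} {φ : E n → ℝ} (hφ : Continuous φ) (d : E n) :
    Continuous fun t : ℝ => ∫ w : Metric.sphere (0 : E n) 1,
      φ (t • (w : E n)) * inner ℝ (w : E n) d ∂(volume : Measure (E n)).toSphere := by
  have : Continuous (fun p : ℝ × Metric.sphere (0 : E n) 1 =>
      φ (p.1 • (p.2 : E n)) * inner ℝ (p.2 : E n) d) := by fun_prop
  have h := continuous_parametric_integral_of_continuous
    (μ := (volume : Measure (E n)).toSphere) (s := univ)
    (f := fun (t : ℝ) (w : Metric.sphere (0 : E n) 1) =>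
      φ (t • (w : E n)) * inner ℝ (w : E n) d) this isCompact_univ
  simpa using h

/-- Let `h → 0` in the preceding identity: the derivative side is at most `C` times the integral of
the cutoff, which tends to the volume of the ball, and the shell side tends to the integral over the
unit sphere. -/
theorem integral_toSphere_mul_inner_le {n : ℕ} (hn : 1 ≤ n) {φ : E n → ℝ} {L : NNReal}
    (hφ : LipschitzWith L φ) {d : E n} {C : ℝ}
    (hC : ∀ᵐ v, ‖v‖ < 1 → lineDeriv ℝ φ v d ≤ C) :
    ∫ w : Metric.sphere (0 : E n) 1, φ w * inner ℝ (w : E n) d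
      ∂(volume : Measure (E n)).toSphere ≤ C * (volume : Measure (E n)).real (Metric.ball 0 1) := by
  have : Nontrivial (E n) := Module.nontrivial_of_finrank_pos (R := ℝ) (by simp; omega)
  set V := (volume : Measure (E n)).real (Metric.ball 0 1) with hV
  let W : ℝ → ℝ := fun t => t ^ (n - 1) * ∫ w : Metric.sphere (0 : E n) 1,
    φ (t • (w : E n)) * inner ℝ (w : E n) d ∂(volume : Measure (E n)).toSphere
  have hW : Continuous W := (continuous_pow _).mul (continuous_integral_sphere hφ.continuous d)
  have hψi : ∀ h : ℝ, 0 < h → Integrable (radialCutoff h : E n → ℝ) := fun h hh =>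
    (radialCutoff_lipschitz hh).continuous.integrable_of_hasCompactSupport
      (radialCutoff_hasCompactSupport hh)
  have hle : ∀ h : ℝ, 0 < h → h < 1 →
      h⁻¹ * ∫ t in (1 - h)..1, W t ≤ C * ∫ v : E n, radialCutoff h v := by
    intro h hh hh1
    rw [← integral_lineDeriv_mul_radialCutoff hn hφ d hh hh1, ← integral_const_mul]
    refine integral_mono_ae ?_ ((hψi h hh).const_mul C) ?_
    · refine (hψi h hh).bdd_mul
        (hφ.memLp_lineDeriv (μ := volume) d).aestronglyMeasurable (c := L * ‖d‖) ?_
      exact .of_forall fun v => norm_lineDeriv_le_of_lipschitz ℝ hφ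
    · filter_upwards [hC] with v hv
      by_cases h1 : ‖v‖ < 1
      · exact mul_le_mul_of_nonneg_right (hv h1) (radialCutoff_mem_Icc h v).1
      · simp [radialCutoff_eq_zero hh (not_lt.1 h1)]
  have hup : ∀ h : ℝ, 0 < h → ∫ v : E n, radialCutoff h v ≤ V := by
    intro h hh
    have h1 : V = ∫ v : E n, (Metric.ball (0 : E n) 1).indicator (fun _ => (1 : ℝ)) v := by
      rw [integral_indicator_const _ Metric.isOpen_ball.measurableSet]; simp [hV]
    rw [h1]
    refine integral_mono (hψi h hh) ?_ fun v => ?_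
    · rw [integrable_indicator_iff Metric.isOpen_ball.measurableSet]
      exact integrableOn_const (by simp [Metric.isBounded_ball.measure_lt_top.ne])
    · by_cases h1 : ‖v‖ < 1
      · rw [indicator_of_mem (by simpa using h1)]
        exact (radialCutoff_mem_Icc h v).2
      · simp only [radialCutoff_eq_zero hh (not_lt.1 h1)]
        exact indicator_nonneg (fun _ _ => zero_le_one) _
  have hlow : ∀ h : ℝ, 0 < h → h < 1 → (1 - h) ^ n * V ≤ ∫ v : E n, radialCutoff h v := by
    intro h hh hh1
    have h1 : (1 - h) ^ n * V =
        ∫ v : E n, (Metric.ball (0 : E n) (1 - h)).indicator (fun _ => (1 : ℝ)) v := by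
      rw [integral_indicator_const _ Metric.isOpen_ball.measurableSet, Measure.real,
        Measure.addHaar_ball _ _ (by linarith : 0 ≤ 1 - h)]
      simp only [finrank_euclideanSpace, Fintype.card_fin, ENNReal.toReal_mul, smul_eq_mul, mul_one]
      rw [ENNReal.toReal_ofReal (by apply pow_nonneg; linarith)]
      rfl
    rw [h1]
    refine integral_mono ?_ (hψi h hh) fun v => ?_
    · rw [integrable_indicator_iff Metric.isOpen_ball.measurableSet]
      exact integrableOn_const (by simp [Metric.isBounded_ball.measure_lt_top.ne])
    · by_cases h1 : ‖v‖ < 1 - h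
      · rw [indicator_of_mem (by simpa using h1), radialCutoff_eq_one hh h1.le]
      · rw [indicator_of_notMem (by simpa using h1)]
        exact (radialCutoff_mem_Icc h v).1
  have hev : ∀ᶠ h : ℝ in 𝓝[>] 0, 0 < h ∧ h < 1 := by
    filter_upwards [Ioo_mem_nhdsGT (zero_lt_one' ℝ)] with h hh using hh
  have hlimV : Tendsto (fun h : ℝ => ∫ v : E n, radialCutoff h v) (𝓝[>] 0) (𝓝 V) := by
    refine tendsto_of_tendsto_of_tendsto_of_le_of_le' (g := fun h : ℝ => (1 - h) ^ n * V)
      (h := fun _ => V) ?_ tendsto_const_nhds ?_ ?_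
    · have : Continuous (fun h : ℝ => (1 - h) ^ n * V) := by fun_prop
      have h2 := (this.tendsto 0).mono_left (nhdsWithin_le_nhds (s := Ioi 0))
      simpa using h2
    · filter_upwards [hev] with h hh using hlow h hh.1 hh.2
    · filter_upwards [hev] with h hh using hup h hh.1
  -- The fundamental theorem of calculus at the endpoint `t = 1`; the two signs, from the lower
  -- limit and from `1 - h`, cancel.
  have hlimW : Tendsto (fun h : ℝ => h⁻¹ * ∫ t in (1 - h)..1, W t) (𝓝[>] 0) (𝓝 (W 1)) := by
    have h1 : HasDerivAt (fun h : ℝ => ∫ t in (1 - h)..1, W t) (W 1) 0 := by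
      have h2 : HasDerivAt (fun a : ℝ => ∫ t in a..1, W t) (-W 1) (1 - 0) := by
        rw [sub_zero]
        exact intervalIntegral.integral_hasDerivAt_left (hW.intervalIntegrable _ _)
          (hW.stronglyMeasurableAtFilter _ _) hW.continuousAt
      have h3 : HasDerivAt (fun h : ℝ => ∫ t in (1 - h)..1, W t) _ 0 :=
        h2.comp (0 : ℝ) ((hasDerivAt_id (0 : ℝ)).const_sub 1)
      simpa using h3
    have h4 := h1.tendsto_slope_zero_right
    simpa using h4
  have hfin := le_of_tendsto_of_tendsto hlimW (hlimV.const_mul C) (by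
    filter_upwards [hev] with h hh using hle h hh.1 hh.2)
  simpa [W] using hfin

instance isProbabilityMeasure_uniformSphere {n : ℕ} [NeZero n] :
    IsProbabilityMeasure (uniformSphere n) := by
  have : Nontrivial (E n) := Module.nontrivial_of_finrank_pos (R := ℝ) (by simp [Nat.pos_of_neZero n])
  refine ⟨?_⟩
  rw [uniformSphere, Measure.map_apply measurable_subtype_coe MeasurableSet.univ]
  simp only [preimage_univ, Measure.smul_apply, smul_eq_mul]
  refine ENNReal.inv_mul_cancel ?_ (measure_ne_top _ _)
  rw [Ne, Measure.measure_univ_eq_zero]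
  exact Measure.toSphere_ne_zero _

theorem ae_norm_eq_one_uniformSphere (n : ℕ) : ∀ᵐ u ∂(uniformSphere n), ‖u‖ = 1 := by
  rw [uniformSphere, ae_map_iff measurable_subtype_coe.aemeasurable
    (measurableSet_eq_fun measurable_norm measurable_const)]
  exact .of_forall fun w => by simp

theorem integral_uniformSphere {n : ℕ} (hn : 1 ≤ n) (g : E n → ℝ) :
    (n : ℝ) * (volume : Measure (E n)).real (Metric.ball 0 1) * ∫ u, g u ∂(uniformSphere n) =
      ∫ w : Metric.sphere (0 : E n) 1, g w ∂(volume : Measure (E n)).toSphere := by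
  have : Nontrivial (E n) := Module.nontrivial_of_finrank_pos (R := ℝ) (by simp; omega)
  have h := (volume : Measure (E n)).toSphere_real_apply_univ
  simp only [finrank_euclideanSpace, Fintype.card_fin] at h
  rw [← h, uniformSphere, (MeasurableEmbedding.subtype_coe
    Metric.isClosed_sphere.measurableSet).integral_map, integral_smul_measure, smul_eq_mul,
    ← mul_assoc, ENNReal.toReal_inv]
  rw [← Measure.real, mul_inv_cancel₀, one_mul]
  rw [Measure.real, ENNReal.toReal_ne_zero]
  refine ⟨?_, measure_ne_top _ _⟩
  rw [Ne, Measure.measure_univ_eq_zero]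
  exact Measure.toSphere_ne_zero _

theorem integral_uniformSphere_mul_inner_le {n : ℕ} (hn : 1 ≤ n) {φ : E n → ℝ} {L : NNReal}
    (hφ : LipschitzWith L φ) {d : E n} {C : ℝ}
    (hC : ∀ᵐ v, ‖v‖ < 1 → lineDeriv ℝ φ v d ≤ C) :
    n * ∫ u, φ u * inner ℝ u d ∂(uniformSphere n) ≤ C := by
  have : Nontrivial (E n) := Module.nontrivial_of_finrank_pos (R := ℝ) (by simp; omega)
  have h1 := integral_toSphere_mul_inner_le hn hφ hC
  rw [← integral_uniformSphere hn (fun u => φ u * inner ℝ u d)] at h1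
  have hV : 0 < (volume : Measure (E n)).real (Metric.ball 0 1) :=
    ENNReal.toReal_pos (Metric.measure_ball_pos _ _ one_pos).ne' measure_ball_lt_top.ne
  nlinarith

/-! ### Subgradients, Lipschitz losses and the shrunk set. -/

/-- Hahn–Banach separates the graph point at `x` from the open strict epigraph. The functional has
negative vertical component `β`, and dividing its horizontal part by `-β` yields the subgradient. -/
theorem exists_mem_subdifferential {n : ℕ} {f : E n → ℝ} (hf : ConvexOn ℝ univ f) (x : E n) :
    ∃ g, g ∈ subdifferential f x := by
  have hc : Continuous f := continuousOn_univ.1 (hf.continuousOn isOpen_univ)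
  have hconv : Convex ℝ {p : E n × ℝ | f p.1 < p.2} := by
    have := hf.convex_strict_epigraph
    simpa using this
  have hopen : IsOpen {p : E n × ℝ | f p.1 < p.2} :=
    isOpen_lt (hc.comp continuous_fst) continuous_snd
  have hnot : (x, f x) ∉ {p : E n × ℝ | f p.1 < p.2} := by simp
  obtain ⟨l, hl⟩ := geometric_hahn_banach_open_point hconv hopen hnot
  set β := l (0, 1) with hβ
  have hsplit : ∀ (y : E n) (s : ℝ), l (y, s) = l (y, 0) + s * β := by
    intro y s
    have h1 : ((y, s) : E n × ℝ) = (y, 0) + s • ((0 : E n), (1 : ℝ)) := by ext <;> simp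
    rw [h1, map_add, map_smul, smul_eq_mul]
  have hβneg : β < 0 := by
    have h1 := hl (x, f x + 1) (by simp)
    rw [hsplit, hsplit x (f x)] at h1
    linarith
  have hβ0 : β ≠ 0 := hβneg.ne
  have hle : ∀ y, l (y, 0) + f y * β ≤ l (x, 0) + f x * β := by
    intro y
    by_contra hcon
    push Not at hcon
    set e := (l (y, 0) + f y * β - (l (x, 0) + f x * β)) with he
    have hepos : 0 < e := by linarith
    -- Graph points are outside the strict epigraph. Raising `(y, f y)` by this height costs only
    -- half of the supposed violation `e`, so a contradiction remains.
    have h1 := hl (y, f y + e / (2 * -β)) (by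
      simp only [mem_ofPred_eq]
      have : 0 < e / (2 * -β) := by apply div_pos hepos; linarith
      linarith)
    rw [hsplit, hsplit x (f x)] at h1
    have h2 : e / (2 * -β) * β = - (e / 2) := by field_simp
    rw [add_mul, h2] at h1
    linarith
  let g₀ : E n →L[ℝ] ℝ := (-β)⁻¹ • (l.comp (ContinuousLinearMap.inl ℝ (E n) ℝ))
  refine ⟨(InnerProductSpace.toDual ℝ (E n)).symm g₀, fun y => ?_⟩
  rw [InnerProductSpace.toDual_symm_apply]
  have h1 : g₀ (y - x) = (-β)⁻¹ * (l (y, 0) - l (x, 0)) := by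
    rw [← map_sub]; simp [g₀]
  rw [h1]
  have h2 := hle y
  have h3 : (-β)⁻¹ * (l (y, 0) - l (x, 0)) ≤ (-β)⁻¹ * ((f y - f x) * -β) :=
    mul_le_mul_of_nonneg_left (by linarith) (inv_nonneg.2 (by linarith))
  have h4 : (-β)⁻¹ * ((f y - f x) * -β) = f y - f x := by
    field_simp
  linarith

theorem abs_sub_le_of_subdifferential_bounded {n : ℕ} {f : E n → ℝ} (hf : ConvexOn ℝ univ f)
    {S : Set (E n)} {G : ℝ} (hG : ∀ x ∈ S, ∀ g ∈ subdifferential f x, ‖g‖ ≤ G) {x y : E n}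
    (hx : x ∈ S) (hy : y ∈ S) : |f x - f y| ≤ G * ‖x - y‖ := by
  have key : ∀ a ∈ S, ∀ b : E n, f a - f b ≤ G * ‖a - b‖ := by
    intro a ha b
    obtain ⟨g, hg⟩ := exists_mem_subdifferential hf a
    have h1 := hg b
    have h2 := abs_le.1 (abs_real_inner_le_norm g (b - a))
    have h3 := mul_le_mul_of_nonneg_right (hG a ha g hg) (norm_nonneg (b - a))
    rw [norm_sub_rev a b]
    linarith [h2.1]
  rw [abs_le]
  have h1 := key x hx y
  have h2 := key y hy x
  rw [norm_sub_rev] at h2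
  constructor <;> linarith

theorem closedBall_subset_of_mem_shrunk {n : ℕ} {S : Set (E n)} {r δ : ℝ} (hS : Convex ℝ S)
    (hrS : Metric.closedBall 0 r ⊆ S) (hr : 0 < r) (hδ : 0 < δ) (hδr : δ ≤ r) {x : E n}
    (hx : x ∈ shrunk S r δ) : Metric.closedBall x δ ⊆ S := by
  obtain ⟨s, hs, rfl⟩ := hx
  intro y hy
  have hd1 : δ / r ≤ 1 := (div_le_one hr).2 hδr
  simp only at hy
  set w := y - (1 - δ / r) • s with hw
  have hwn : ‖w‖ ≤ δ := by rwa [mem_closedBall_iff_norm] at hy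
  -- The point is `(1 - δ/r) s + (δ/r) ((r/δ) w)`, a convex combination of two points of `S`.
  have hw2 : (r / δ) • w ∈ S := by
    apply hrS
    rw [mem_closedBall_zero_iff, norm_smul, Real.norm_eq_abs, abs_of_pos (by positivity)]
    calc r / δ * ‖w‖ ≤ r / δ * δ := by gcongr
      _ = r := by field_simp
  have h := hS hs hw2 (by linarith : 0 ≤ 1 - δ / r) (by positivity : 0 ≤ δ / r) (by ring)
  convert h using 1
  rw [smul_smul, div_mul_div_cancel₀ hr.ne', div_self hδ.ne', one_smul, hw]
  abel

/-! ### The mean of the one-point gradient estimate. -/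

/-- The mean of the one-point gradient estimate of `f` at `x`. -/
noncomputable def sphereGrad {n : ℕ} (f : E n → ℝ) (δ : ℝ) (x : E n) : E n :=
  ∫ u, ((n : ℝ) / δ * f (x + δ • u)) • u ∂(uniformSphere n)

theorem integrable_uniformSphere {n : ℕ} [NeZero n] {F : Type*} [NormedAddCommGroup F]
    [SecondCountableTopology F] {g : E n → F} (hg : Continuous g) :
    Integrable g (uniformSphere n) := by
  obtain ⟨C, hC⟩ := (isCompact_sphere (0 : E n) 1).exists_bound_of_continuousOn hg.continuousOn
  refine Integrable.of_bound hg.aestronglyMeasurable C ?_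
  filter_upwards [ae_norm_eq_one_uniformSphere n] with u hu
  exact hC u (by simpa using hu)

theorem inner_sphereGrad {n : ℕ} [NeZero n] {f : E n → ℝ} (hf : Continuous f) (δ : ℝ) (x d : E n) :
    inner ℝ (sphereGrad f δ x) d =
      ∫ u, (n : ℝ) / δ * f (x + δ • u) * inner ℝ u d ∂(uniformSphere n) := by
  rw [sphereGrad, real_inner_comm, ← integral_inner]
  · simp_rw [real_inner_smul_right, real_inner_comm d]
  · exact integrable_uniformSphere (by fun_prop)

/-- One-sided difference quotients suffice, because a Lipschitz function has line derivatives almost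
everywhere. The rescaled loss `v ↦ f (x + δ v)` is known to be Lipschitz on the unit ball only,
hence the extension `φ`. -/
theorem inner_sphereGrad_le {n : ℕ} [NeZero n] {f : E n → ℝ} (hf : Continuous f)
    {δ G C : ℝ} (hδ : 0 < δ) (hG : 0 ≤ G) {x d : E n}
    (hlip : ∀ a ∈ Metric.closedBall x δ, ∀ b ∈ Metric.closedBall x δ, |f a - f b| ≤ G * ‖a - b‖)
    (hC : ∀ v : E n, ‖v‖ < 1 →
      ∀ᶠ s : ℝ in 𝓝[>] 0, f (x + δ • (v + s • d)) - f (x + δ • v) ≤ s * (δ * C)) :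
    inner ℝ (sphereGrad f δ x) d ≤ C := by
  have hmem : ∀ v ∈ Metric.closedBall (0 : E n) 1, x + δ • v ∈ Metric.closedBall x δ := by
    intro v hv
    rw [mem_closedBall_iff_norm, add_sub_cancel_left, norm_smul, Real.norm_eq_abs, abs_of_pos hδ]
    have : ‖v‖ ≤ 1 := by simpa using hv
    nlinarith
  have hlip' : LipschitzOnWith (Real.toNNReal (δ * G)) (fun v => f (x + δ • v))
      (Metric.closedBall 0 1) := by
    refine LipschitzOnWith.of_dist_le_mul fun v hv w hw => ?_
    rw [Real.coe_toNNReal _ (by positivity), Real.dist_eq, dist_eq_norm]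
    refine (hlip _ (hmem v hv) _ (hmem w hw)).trans_eq ?_
    rw [add_sub_add_left_eq_sub, ← smul_sub, norm_smul, Real.norm_eq_abs, abs_of_pos hδ]
    ring
  obtain ⟨φ, hφ, heq⟩ := hlip'.extend_real
  have hae : ∀ᵐ v, ‖v‖ < 1 → lineDeriv ℝ φ v d ≤ δ * C := by
    filter_upwards [hφ.ae_lineDifferentiableAt (μ := volume) d] with v hv hv1
    refine le_of_tendsto hv.hasLineDerivAt.tendsto_slope_zero_right ?_
    have hc : ContinuousAt (fun s : ℝ => ‖v + s • d‖) 0 := by fun_prop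
    have hlt : ∀ᶠ s : ℝ in 𝓝[>] 0, ‖v + s • d‖ < 1 :=
      (hc.eventually (gt_mem_nhds (by simpa using hv1))).filter_mono nhdsWithin_le_nhds
    filter_upwards [hC v hv1, hlt, self_mem_nhdsWithin] with s h1 h2 (h3 : 0 < s)
    rw [← heq (by simpa using h2.le), ← heq (by simpa using hv1.le), smul_eq_mul,
      inv_mul_le_iff₀ h3]
    exact h1
  have hmain := integral_uniformSphere_mul_inner_le (NeZero.one_le) hφ hae
  rw [inner_sphereGrad hf]
  have h1 : ∫ u, (n : ℝ) / δ * f (x + δ • u) * inner ℝ u d ∂(uniformSphere n) =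
      δ⁻¹ * (n * ∫ u, φ u * inner ℝ u d ∂(uniformSphere n)) := by
    rw [← integral_const_mul, ← integral_const_mul]
    refine integral_congr_ae ?_
    filter_upwards [ae_norm_eq_one_uniformSphere n] with u hu
    rw [← heq (by simpa using hu.le)]
    field_simp
  rw [h1, inv_mul_le_iff₀ hδ]
  exact hmain

/-- Testing `inner_sphereGrad_le` in the direction of the vector itself gives `‖g‖² ≤ G‖g‖`. -/
theorem norm_sphereGrad_le {n : ℕ} [NeZero n] {f : E n → ℝ} (hf : Continuous f)
    {δ G : ℝ} (hδ : 0 < δ) (hG : 0 ≤ G) {x : E n}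
    (hlip : ∀ a ∈ Metric.closedBall x δ, ∀ b ∈ Metric.closedBall x δ,
      |f a - f b| ≤ G * ‖a - b‖) :
    ‖sphereGrad f δ x‖ ≤ G := by
  set g := sphereGrad f δ x with hg
  have h : inner ℝ g g ≤ G * ‖g‖ := by
    refine inner_sphereGrad_le hf hδ hG hlip fun v hv => ?_
    have hc : ContinuousAt (fun s : ℝ => ‖v + s • g‖) 0 := by fun_prop
    have hlt : ∀ᶠ s : ℝ in 𝓝[>] 0, ‖v + s • g‖ < 1 :=
      (hc.eventually (gt_mem_nhds (by simpa using hv))).filter_mono nhdsWithin_le_nhds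
    filter_upwards [hlt, self_mem_nhdsWithin] with s h2 (h3 : 0 < s)
    have hmem : ∀ w : E n, ‖w‖ < 1 → x + δ • w ∈ Metric.closedBall x δ := by
      intro w hw
      rw [mem_closedBall_iff_norm, add_sub_cancel_left, norm_smul, Real.norm_eq_abs,
        abs_of_pos hδ]
      nlinarith
    refine (le_abs_self _).trans ((hlip _ (hmem _ h2) _ (hmem _ hv)).trans_eq ?_)
    rw [add_sub_add_left_eq_sub, ← smul_sub, add_sub_cancel_left, norm_smul, norm_smul,
      Real.norm_eq_abs, Real.norm_eq_abs, abs_of_pos hδ, abs_of_pos h3]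
    ring
  rw [real_inner_self_eq_norm_sq] at h
  rcases (norm_nonneg g).eq_or_lt with h0 | h0
  · rw [← h0]; exact hG
  · nlinarith

/-- A step `s` in direction `z - x` from `v` gives the convex combination of `x + δv` and `z + δv`
with weight `sδ` on the latter. Convexity bounds the slope by `δ (f (z + δv) - f (x + δv))`, and
removing the two shifts `δv` costs `δG` each. -/
theorem sub_le_inner_sphereGrad {n : ℕ} [NeZero n] {f : E n → ℝ} (hf : ConvexOn ℝ univ f)
    {S : Set (E n)} {δ G : ℝ} (hδ : 0 < δ) (hG : 0 ≤ G)
    (hlip : ∀ a ∈ S, ∀ b ∈ S, |f a - f b| ≤ G * ‖a - b‖) {x z : E n}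
    (hx : Metric.closedBall x δ ⊆ S) (hz : Metric.closedBall z δ ⊆ S) :
    f x - f z ≤ inner ℝ (sphereGrad f δ x) (x - z) + 2 * δ * G := by
  have hc : Continuous f := continuousOn_univ.1 (hf.continuousOn isOpen_univ)
  have h : inner ℝ (sphereGrad f δ x) (z - x) ≤ f z - f x + 2 * δ * G := by
    refine inner_sphereGrad_le hc hδ hG (fun a ha b hb => hlip a (hx ha) b (hx hb)) fun v hv => ?_
    filter_upwards [Ioo_mem_nhdsGT (inv_pos.2 hδ)] with s hs
    have hsδ : s * δ ≤ 1 := by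
      have := mul_le_mul_of_nonneg_right hs.2.le hδ.le
      rwa [inv_mul_cancel₀ hδ.ne'] at this
    have hsδ0 : 0 ≤ s * δ := mul_nonneg hs.1.le hδ.le
    have hcv := hf.2 (mem_univ (x + δ • v)) (mem_univ (z + δ • v))
      (by linarith : 0 ≤ 1 - s * δ) hsδ0 (by ring)
    have hpt : (1 - s * δ) • (x + δ • v) + (s * δ) • (z + δ • v) =
        x + δ • (v + s • (z - x)) := by
      module
    rw [hpt] at hcv
    simp only [smul_eq_mul] at hcv
    have hvn : ∀ y : E n, Metric.closedBall y δ ⊆ S → |f (y + δ • v) - f y| ≤ δ * G := by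
      intro y hy
      refine (hlip _ (hy ?_) _ (hy (Metric.mem_closedBall_self hδ.le))).trans ?_
      · rw [mem_closedBall_iff_norm, add_sub_cancel_left, norm_smul, Real.norm_eq_abs,
          abs_of_pos hδ]
        nlinarith
      · rw [add_sub_cancel_left, norm_smul, Real.norm_eq_abs, abs_of_pos hδ]
        have : δ * ‖v‖ ≤ δ * 1 := by gcongr
        nlinarith
    have h1 := abs_le.1 (hvn x hx)
    have h2 := abs_le.1 (hvn z hz)
    have h3 : s * δ * (f (z + δ • v) - f (x + δ • v)) ≤ s * δ * (f z - f x + 2 * δ * G) :=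
      mul_le_mul_of_nonneg_left (by linarith [h1.1, h2.2]) hsδ0
    linarith
  have h4 : inner ℝ (sphereGrad f δ x) (x - z) = - inner ℝ (sphereGrad f δ x) (z - x) := by
    rw [← inner_neg_right, neg_sub]
  rw [h4]
  linarith

/-! ### Conditional gradient iterations on a squared distance. -/

section ConditionalGradient

variable {n : ℕ} {S : Set (E n)} {ε R c : ℝ} {xin xout a : E n} {F : E n → ℝ} {z v : ℕ → E n}

theorem gradient_sq_dist (hF : F = fun p => ‖p - a‖ ^ 2 + c) (p : E n) :
    gradient F p = (2 : ℝ) • (p - a) := by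
  refine HasGradientAt.gradient ?_
  rw [hasGradientAt_iff_hasFDerivAt, hF]
  have h := (((hasFDerivAt_id (𝕜 := ℝ) p).sub_const a).norm_sq).add_const c
  refine h.congr_fderiv ?_
  ext w
  simp

theorem sq_dist_add_smul (hF : F = fun p => ‖p - a‖ ^ 2 + c) (p q : E n) (s : ℝ) :
    F (p + s • (q - p)) =
      F p - s * inner ℝ ((2 : ℝ) • (p - a)) (p - q) + s ^ 2 * ‖q - p‖ ^ 2 := by
  have h1 : p + s • (q - p) - a = (p - a) + s • (q - p) := by abel
  have h2 : inner ℝ (p - a) (p - q) = - inner ℝ (p - a) (q - p) := by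
    rw [← inner_neg_right, neg_sub]
  simp only [hF]
  rw [h1, norm_add_sq_real, norm_smul, real_inner_smul_right, real_inner_smul_left, h2, mul_pow,
    Real.norm_eq_abs, sq_abs]
  ring

theorem sq_dist_sub_eq (hF : F = fun p => ‖p - a‖ ^ 2 + c) (p q : E n) :
    F p - F q + ‖p - q‖ ^ 2 = inner ℝ ((2 : ℝ) • (p - a)) (p - q) := by
  have h := sq_dist_add_smul hF p q 1
  rw [one_smul, add_sub_cancel] at h
  rw [h, norm_sub_rev q p]
  ring

theorem CGReached.pred {τ : ℕ} (hτ : 1 ≤ τ) (h : CGReached F ε z v (τ + 1)) :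
    CGReached F ε z v τ ∧ ¬ CGStop F ε z v τ :=
  ⟨⟨hτ, fun j hj hjτ => h.2 j hj (by omega)⟩, h.2 τ hτ (by omega)⟩

theorem IsCGRun.mem (hrun : IsCGRun S ε xin F z v xout) (hS : Convex ℝ S) (hin : xin ∈ S) :
    ∀ τ, CGReached F ε z v τ → z τ ∈ S := by
  intro τ hτ
  obtain ⟨τ, rfl⟩ := Nat.exists_eq_add_of_le' hτ.1
  induction τ with
  | zero => rw [hrun.init]; exact hin
  | succ τ ih =>
    have h := (hτ.pred (by omega)).1
    obtain ⟨σ, hσ, -, heq⟩ := hrun.line_search _ h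
    rw [heq]
    exact hS.add_smul_sub_mem (ih h) (hrun.oracle _ h).1 hσ

/-- The line search does at least as well as any fixed step `s`, and the quadratic term is at most
`(2R)² s²`. -/
theorem IsCGRun.le_of_step (hrun : IsCGRun S ε xin F z v xout) (hF : F = fun p => ‖p - a‖ ^ 2 + c)
    (hS : Convex ℝ S) (hin : xin ∈ S) (hSR : S ⊆ Metric.closedBall 0 R) {τ : ℕ}
    (hτ : CGReached F ε z v τ) {s : ℝ} (hs : s ∈ Icc (0 : ℝ) 1) :
    F (z (τ + 1)) ≤
      F (z τ) - s * inner ℝ (gradient F (z τ)) (z τ - v τ) + 4 * R ^ 2 * s ^ 2 := by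
  obtain ⟨σ, hσ, hmin, heq⟩ := hrun.line_search τ hτ
  have h1 := hmin hs
  simp only [mem_ofPred_eq] at h1
  rw [heq]
  refine h1.trans ?_
  rw [sq_dist_add_smul hF, gradient_sq_dist hF]
  have hz := hSR (hrun.mem hS hin τ hτ)
  have hv := hSR (hrun.oracle τ hτ).1
  rw [mem_closedBall_zero_iff] at hz hv
  have h2 : ‖v τ - z τ‖ ≤ 2 * R := (norm_sub_le _ _).trans (by linarith)
  have h3 : ‖v τ - z τ‖ ^ 2 ≤ (2 * R) ^ 2 := by gcongr
  nlinarith [sq_nonneg s]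

theorem IsCGRun.sub_le_gap (hrun : IsCGRun S ε xin F z v xout) {τ : ℕ}
    (hτ : CGReached F ε z v τ) {p : E n} (hp : p ∈ S) :
    inner ℝ (gradient F (z τ)) (z τ - p) ≤ inner ℝ (gradient F (z τ)) (z τ - v τ) := by
  have h := (hrun.oracle τ hτ).2 hp
  simp only [mem_ofPred_eq] at h
  rw [inner_sub_right, inner_sub_right]
  linarith

/-- While the loop runs the gap exceeds `ε = 16R²/k`. The step `2/k`, admissible since `2 ≤ k`,
maximises `s ε - 4R² s²`, with value `16R²/k²`. -/
theorem IsCGRun.linear_decrease (hrun : IsCGRun S ε xin F z v xout)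
    (hF : F = fun p => ‖p - a‖ ^ 2 + c) (hS : Convex ℝ S) (hin : xin ∈ S)
    (hSR : S ⊆ Metric.closedBall 0 R) {k : ℕ} (hk : 2 ≤ k)
    (hε : ε = 16 * R ^ 2 / k) {τ : ℕ} (hτ : 1 ≤ τ) (j : ℕ) (h : CGReached F ε z v (τ + j)) :
    F (z (τ + j)) ≤ F (z τ) - j * (16 * R ^ 2 / k ^ 2) := by
  have hk' : (2 : ℝ) ≤ k := by exact_mod_cast hk
  induction j with
  | zero => simp
  | succ j ih =>
    obtain ⟨h1, h2⟩ := CGReached.pred (τ := τ + j) (by omega) h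
    have h3 := ih h1
    have hs : (2 / k : ℝ) ∈ Icc (0 : ℝ) 1 := ⟨by positivity, by rw [div_le_one] <;> linarith⟩
    have h4 := hrun.le_of_step hF hS hin hSR h1 hs
    rw [CGStop, not_le] at h2
    have h5 : 2 / (k : ℝ) * ε ≤ 2 / k * inner ℝ (gradient F (z (τ + j))) (z (τ + j) - v (τ + j)) :=
      mul_le_mul_of_nonneg_left h2.le hs.1
    have h6 : 2 / (k : ℝ) * ε - 4 * R ^ 2 * (2 / k) ^ 2 = 16 * R ^ 2 / k ^ 2 := by
      rw [hε]; field_simp; ring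
    push_cast
    rw [← add_assoc]
    linarith

/-- The classical Frank–Wolfe recursion with steps `1` and then `2/t`. By convexity the gap
dominates `F (z τ) - F p` for every `p ∈ S`, so `p` need not be a minimizer. -/
theorem IsCGRun.sublinear_bound (hrun : IsCGRun S ε xin F z v xout)
    (hF : F = fun p => ‖p - a‖ ^ 2 + c) (hS : Convex ℝ S) (hin : xin ∈ S)
    (hSR : S ⊆ Metric.closedBall 0 R) {p : E n} (hp : p ∈ S) (j : ℕ)
    (h : CGReached F ε z v (j + 2)) :
    F (z (j + 2)) - F p ≤ 16 * R ^ 2 / (j + 2) := by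
  have hgap : ∀ τ, CGReached F ε z v τ →
      F (z τ) - F p ≤ inner ℝ (gradient F (z τ)) (z τ - v τ) := by
    intro τ hτ
    refine le_trans ?_ (hrun.sub_le_gap hτ hp)
    rw [gradient_sq_dist hF, ← sq_dist_sub_eq hF]
    nlinarith [sq_nonneg ‖z τ - p‖]
  induction j with
  | zero =>
    have h1 := (CGReached.pred (by omega) h).1
    have h2 := hrun.le_of_step hF hS hin hSR h1 (s := 1) (by simp)
    have h3 := hgap _ h1
    simp only [zero_add, Nat.cast_zero] at *
    have : (1 : ℕ) + 1 = 2 := rfl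
    simp only [this] at h2
    nlinarith [sq_nonneg R]
  | succ j ih =>
    have h1 := (CGReached.pred (τ := j + 2) (by omega) h).1
    have h0 := ih h1
    set t : ℝ := (j : ℝ) + 2 with ht
    have ht2 : 2 ≤ t := by rw [ht]; linarith [(Nat.cast_nonneg j : (0 : ℝ) ≤ j)]
    have hs : 2 / t ∈ Icc (0 : ℝ) 1 := ⟨by positivity, by rw [div_le_one] <;> linarith⟩
    have h2 := hrun.le_of_step hF hS hin hSR h1 hs
    have h3 := mul_le_mul_of_nonneg_left (hgap _ h1) hs.1
    have h4 : (1 - 2 / t) * (F (z (j + 2)) - F p) ≤ (1 - 2 / t) * (16 * R ^ 2 / t) :=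
      mul_le_mul_of_nonneg_left h0 (by linarith [hs.2])
    have h5 : (1 - 2 / t) * (16 * R ^ 2 / t) + 4 * R ^ 2 * (2 / t) ^ 2 ≤ 16 * R ^ 2 / (t + 1) := by
      have : (1 - 2 / t) * (16 * R ^ 2 / t) + 4 * R ^ 2 * (2 / t) ^ 2 =
          16 * R ^ 2 / (t + 1) - 16 * R ^ 2 / (t ^ 2 * (t + 1)) := by
        field_simp; ring
      rw [this]
      have : 0 ≤ 16 * R ^ 2 / (t ^ 2 * (t + 1)) := by positivity
      linarith
    have h6 : ((j + 1 : ℕ) : ℝ) + 2 = t + 1 := by push_cast; rw [ht]; ring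
    have h7 : j + 1 + 2 = j + 2 + 1 := by ring
    rw [h6, h7]
    linarith

theorem IsCGRun.exists_iterations (hrun : IsCGRun S ε xin F z v xout)
    (hF : F = fun p => ‖p - a‖ ^ 2 + c) (hS : Convex ℝ S) (hin : xin ∈ S)
    (hSR : S ⊆ Metric.closedBall 0 R) (hR : 0 < R) {k : ℕ} (hk : 2 ≤ k)
    (hε : ε = 16 * R ^ 2 / k) :
    ∃ L : ℕ, L ≤ 2 * k ∧ cgIterations F ε z v ≤ L ∧ xout ∈ S ∧
      ((L : ℝ) - 1) * (16 * R ^ 2 / k ^ 2) ≤ F xin - F xout ∧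
      ∀ p ∈ S, inner ℝ ((2 : ℝ) • (xout - a)) (xout - p) ≤ ε := by
  classical
  -- If iteration `2k + 1` were reached, the `k + 1` iterations from `k` on would lower `F` by `(k +
  -- 1) 16R²/k²`. But `sublinear_bound` at iteration `k`, with the iterate `2k + 1` as comparator,
  -- allows only `16R²/k`.
  have hnot : ¬ CGReached F ε z v (k + (k + 1)) := by
    intro hreach
    have hk1 : CGReached F ε z v k := ⟨by omega, fun j hj hjk => hreach.2 j hj (by omega)⟩
    have hmem := hrun.mem hS hin _ hreach
    have h1 := hrun.linear_decrease hF hS hin hSR hk hε (by omega) _ hreach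
    obtain ⟨i, rfl⟩ := Nat.exists_eq_add_of_le' hk
    have h2 := hrun.sublinear_bound hF hS hin hSR hmem i hk1
    push_cast at h1 h2
    have h3 : ((i : ℝ) + 2 + 1) * (16 * R ^ 2 / ((i : ℝ) + 2) ^ 2) =
        16 * R ^ 2 / (i + 2) + 16 * R ^ 2 / ((i : ℝ) + 2) ^ 2 := by
      field_simp
    have h4 : 0 < 16 * R ^ 2 / ((i : ℝ) + 2) ^ 2 := by positivity
    linarith
  have hex : ∃ τ, 1 ≤ τ ∧ CGStop F ε z v τ := by
    by_contra hcon
    push Not at hcon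
    exact hnot ⟨by omega, fun j hj _ => hcon j hj⟩
  set L := Nat.find hex with hL
  obtain ⟨hL1, htest⟩ := Nat.find_spec hex
  have hreach : CGReached F ε z v L := ⟨hL1, fun j hj hjL hs => Nat.find_min hex hjL ⟨hj, hs⟩⟩
  have hout := hrun.output L hreach htest
  refine ⟨L, ?_, iInf₂_le (f := fun (τ : ℕ) (_ : 1 ≤ τ ∧ CGStop F ε z v τ) => (τ : ℕ∞)) L
    ⟨hL1, htest⟩, hout ▸ hrun.mem hS hin L hreach, ?_, ?_⟩
  · by_contra hcon
    exact hnot ⟨by omega, fun j hj hjk => hreach.2 j hj (by omega)⟩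
  · have h1 : 1 + (L - 1) = L := by omega
    have h := hrun.linear_decrease hF hS hin hSR hk hε le_rfl (L - 1) (by rwa [h1])
    rw [h1, hrun.init, Nat.cast_sub hL1, Nat.cast_one] at h
    rw [hout]
    linarith
  · intro p hp
    rw [hout, ← gradient_sq_dist hF]
    exact (hrun.sub_le_gap hreach hp).trans htest

end ConditionalGradient

/-! ### Projections and the regularised leader. -/

theorem exists_proj {n : ℕ} {S : Set (E n)} (hne : S.Nonempty) (hcl : IsClosed S)
    (hS : Convex ℝ S) :
    ∃ P : E n → E n, (∀ a, P a ∈ S) ∧ (∀ a, ∀ w ∈ S, inner ℝ (a - P a) (w - P a) ≤ 0) ∧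
      LipschitzWith 1 P := by
  have h : ∀ a : E n, ∃ p ∈ S, ∀ w ∈ S, inner ℝ (a - p) (w - p) ≤ 0 := by
    intro a
    obtain ⟨p, hp, heq⟩ := exists_norm_eq_iInf_of_complete_convex hne hcl.isComplete hS a
    exact ⟨p, hp, (norm_eq_iInf_iff_real_inner_le_zero hS hp).1 heq⟩
  choose P hP hPi using h
  refine ⟨P, hP, hPi, LipschitzWith.of_dist_le_mul fun a b => ?_⟩
  rw [NNReal.coe_one, one_mul, dist_eq_norm, dist_eq_norm]
  have h1 := hPi a (P b) (hP b)
  have h2 := hPi b (P a) (hP a)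
  have h3 : ‖P a - P b‖ ^ 2 ≤ inner ℝ (a - b) (P a - P b) := by
    rw [← real_inner_self_eq_norm_sq]
    have h4 : inner ℝ (a - b) (P a - P b) - inner ℝ (P a - P b) (P a - P b) =
        - (inner ℝ (a - P a) (P b - P a) + inner ℝ (b - P b) (P a - P b)) := by
      rw [← neg_sub (P a) (P b), inner_neg_right, neg_add, neg_neg, ← sub_eq_add_neg,
        ← inner_sub_left, ← inner_sub_left]
      congr 1
      abel
    linarith
  have h5 := h3.trans (real_inner_le_norm _ _)
  rcases (norm_nonneg (P a - P b)).eq_or_lt with h0 | h0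
  · rw [← h0]; positivity
  · nlinarith

section FollowTheLeader

variable {n : ℕ} {S : Set (E n)} {η : ℝ} {g : ℕ → E n} {x₁ : E n} {P : E n → E n}

/-- The regularised cumulative linear loss `q ↦ η ∑_{i < m} ⟪q, g i⟫ + ‖q - x₁‖²`. -/
noncomputable def ftrlObjective (η : ℝ) (g : ℕ → E n) (x₁ : E n) (m : ℕ) (q : E n) : ℝ :=
  η * ∑ i ∈ Finset.Icc 1 (m - 1), inner ℝ q (g i) + ‖q - x₁‖ ^ 2

/-- The unconstrained minimizer of `ftrlObjective`. -/
noncomputable def ftrlCenter (η : ℝ) (g : ℕ → E n) (x₁ : E n) (m : ℕ) : E n :=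
  x₁ - (η / 2) • ∑ i ∈ Finset.Icc 1 (m - 1), g i

theorem ftrlObjective_eq (m : ℕ) : ftrlObjective η g x₁ m = fun q =>
    ‖q - ftrlCenter η g x₁ m‖ ^ 2 + (‖x₁‖ ^ 2 - ‖ftrlCenter η g x₁ m‖ ^ 2) := by
  funext q
  rw [ftrlObjective, ← inner_sum, ftrlCenter]
  set s := ∑ i ∈ Finset.Icc 1 (m - 1), g i
  rw [norm_sub_sq_real q, norm_sub_sq_real q, inner_sub_right, real_inner_smul_right]
  ring

theorem ftrlCenter_one : ftrlCenter η g x₁ 1 = x₁ := by simp [ftrlCenter]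

theorem ftrlCenter_succ {m : ℕ} (hm : 1 ≤ m) :
    ftrlCenter η g x₁ (m + 1) = ftrlCenter η g x₁ m - (η / 2) • g m := by
  obtain ⟨m, rfl⟩ := Nat.exists_eq_add_of_le' hm
  simp only [ftrlCenter, Nat.add_sub_cancel]
  rw [Finset.sum_Icc_succ_top (by omega), smul_add]
  abel

theorem ftrlObjective_succ {m : ℕ} (hm : 1 ≤ m) (q : E n) :
    ftrlObjective η g x₁ (m + 1) q = ftrlObjective η g x₁ m q + η * inner ℝ q (g m) := by
  obtain ⟨m, rfl⟩ := Nat.exists_eq_add_of_le' hm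
  simp only [ftrlObjective, Nat.add_sub_cancel]
  rw [Finset.sum_Icc_succ_top (by omega)]
  ring

theorem ftrlObjective_one (q : E n) : ftrlObjective η g x₁ 1 q = ‖q - x₁‖ ^ 2 := by
  simp [ftrlObjective]

/-- Up to a constant the objective is the squared distance to its centre, so the projection of the
centre is the constrained minimizer. -/
theorem ftrlObjective_quadratic_growth
    (hP : ∀ a, ∀ w ∈ S, inner ℝ (a - P a) (w - P a) ≤ 0) (m : ℕ) {q : E n} (hq : q ∈ S) :
    ftrlObjective η g x₁ m (P (ftrlCenter η g x₁ m)) + ‖q - P (ftrlCenter η g x₁ m)‖ ^ 2 ≤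
      ftrlObjective η g x₁ m q := by
  set a := ftrlCenter η g x₁ m
  have h1 := sq_dist_sub_eq (ftrlObjective_eq (η := η) (g := g) (x₁ := x₁) m) (P a) q
  have h2 := hP a q hq
  have h3 : inner ℝ ((2 : ℝ) • (P a - a)) (P a - q) = 2 * inner ℝ (a - P a) (q - P a) := by
    rw [real_inner_smul_left, ← neg_sub a, ← neg_sub q, inner_neg_neg]
  rw [h3, norm_sub_rev] at h1
  linarith

/-- Moving the leader from `p` to `p'` costs `‖p' - p‖²` and gains at most `η⟪p - p', g m⟫`;
completing the square bounds the net gain by `η²/4 ‖g m‖²`. -/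
theorem ftrlObjective_min_succ_ge
    (hPS : ∀ a, P a ∈ S) (hP : ∀ a, ∀ w ∈ S, inner ℝ (a - P a) (w - P a) ≤ 0)
    {m : ℕ} (hm : 1 ≤ m) :
    ftrlObjective η g x₁ m (P (ftrlCenter η g x₁ m)) +
        (η * inner ℝ (P (ftrlCenter η g x₁ m)) (g m) - η ^ 2 / 4 * ‖g m‖ ^ 2) ≤
      ftrlObjective η g x₁ (m + 1) (P (ftrlCenter η g x₁ (m + 1))) := by
  set p := P (ftrlCenter η g x₁ m)
  set p' := P (ftrlCenter η g x₁ (m + 1))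
  have h1 : _ ≤ ftrlObjective η g x₁ m p' := ftrlObjective_quadratic_growth hP m (hPS _)
  rw [ftrlObjective_succ hm]
  have h2 : 0 ≤ ‖(p' - p) + (η / 2) • g m‖ ^ 2 := sq_nonneg _
  rw [norm_add_sq_real, real_inner_smul_right, norm_smul, mul_pow, Real.norm_eq_abs, sq_abs,
    inner_sub_left] at h2
  linarith

theorem ftrlObjective_min_ge
    (hPS : ∀ a, P a ∈ S) (hP : ∀ a, ∀ w ∈ S, inner ℝ (a - P a) (w - P a) ≤ 0)
    (m : ℕ) :
    ∑ i ∈ Finset.Icc 1 m, (η * inner ℝ (P (ftrlCenter η g x₁ i)) (g i)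
        - η ^ 2 / 4 * ‖g i‖ ^ 2) ≤
      ftrlObjective η g x₁ (m + 1) (P (ftrlCenter η g x₁ (m + 1))) := by
  induction m with
  | zero =>
    simp only [zero_add, ftrlObjective_one]
    simp
  | succ m ih =>
    rw [Finset.sum_Icc_succ_top (by omega)]
    have := ftrlObjective_min_succ_ge hPS hP (m := m + 1) (by omega) (η := η) (g := g) (x₁ := x₁)
    linarith

theorem ftrl_regret
    (hPS : ∀ a, P a ∈ S) (hP : ∀ a, ∀ w ∈ S, inner ℝ (a - P a) (w - P a) ≤ 0)
    (k : ℕ) {w : E n} (hw : w ∈ S) :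
    η * ∑ m ∈ Finset.Icc 1 k, inner ℝ (g m) (P (ftrlCenter η g x₁ m) - w) ≤
      ‖w - x₁‖ ^ 2 + η ^ 2 / 4 * ∑ m ∈ Finset.Icc 1 k, ‖g m‖ ^ 2 := by
  have h1 := ftrlObjective_min_ge hPS hP k (η := η) (g := g) (x₁ := x₁)
  have h2 := ftrlObjective_quadratic_growth hP (k + 1) hw (η := η) (g := g) (x₁ := x₁)
  have h3 : ftrlObjective η g x₁ (k + 1) w =
      η * ∑ m ∈ Finset.Icc 1 k, inner ℝ w (g m) + ‖w - x₁‖ ^ 2 := rfl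
  rw [Finset.sum_sub_distrib, ← Finset.mul_sum, ← Finset.mul_sum] at h1
  have h4 : ∑ m ∈ Finset.Icc 1 k, inner ℝ (g m) (P (ftrlCenter η g x₁ m) - w) =
      ∑ m ∈ Finset.Icc 1 k, inner ℝ (P (ftrlCenter η g x₁ m)) (g m) -
        ∑ m ∈ Finset.Icc 1 k, inner ℝ w (g m) := by
    rw [← Finset.sum_sub_distrib]
    refine Finset.sum_congr rfl fun m _ => ?_
    rw [inner_sub_right, real_inner_comm, real_inner_comm w]
  rw [h4, mul_sub]
  nlinarith [sq_nonneg ‖w - P (ftrlCenter η g x₁ (k + 1))‖]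

/-- The objective at `x (m - 1)` changes only by `η⟪x (m - 1), g (m - 1)⟫` when its index goes from
`m - 1` to `m`, so the sum telescopes, starting from the value `0` at `x 1`. The final value is
bounded below through `ftrlObjective_min_ge`, leaving only the distances to the leaders. -/
theorem ftrl_progress_le
    (hPS : ∀ a, P a ∈ S) (hP : ∀ a, ∀ w ∈ S, inner ℝ (a - P a) (w - P a) ≤ 0)
    (hη : 0 ≤ η) {x : ℕ → E n} (hx : ∀ m, 1 ≤ m → x m ∈ S) (j : ℕ) :
    ∑ m ∈ Finset.Icc 2 (j + 1),
        (ftrlObjective η g (x 1) m (x (m - 1)) - ftrlObjective η g (x 1) m (x m)) ≤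
      ∑ m ∈ Finset.Icc 1 j, (η * (‖g m‖ * ‖x m - P (ftrlCenter η g (x 1) m)‖)
        + η ^ 2 / 4 * ‖g m‖ ^ 2) := by
  have htel : ∑ m ∈ Finset.Icc 2 (j + 1),
      (ftrlObjective η g (x 1) m (x (m - 1)) - ftrlObjective η g (x 1) m (x m)) =
      ∑ m ∈ Finset.Icc 1 j, η * inner ℝ (x m) (g m)
        - ftrlObjective η g (x 1) (j + 1) (x (j + 1)) := by
    induction j with
    | zero => simp [ftrlObjective_one]
    | succ j ih =>
      rw [Finset.sum_Icc_succ_top (by omega), ih, Finset.sum_Icc_succ_top (by omega),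
        Nat.add_sub_cancel, ftrlObjective_succ (m := j + 1) (by omega) (x (j + 1))]
      ring
  have h1 := ftrlObjective_min_ge hPS hP j (η := η) (g := g) (x₁ := x 1)
  have h2 := ftrlObjective_quadratic_growth hP (j + 1) (hx (j + 1) (by omega))
    (η := η) (g := g) (x₁ := x 1)
  have h3 : ∑ m ∈ Finset.Icc 1 j, η * inner ℝ (x m) (g m) ≤
      ∑ m ∈ Finset.Icc 1 j, (η * (‖g m‖ * ‖x m - P (ftrlCenter η g (x 1) m)‖)
        + η ^ 2 / 4 * ‖g m‖ ^ 2) +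
      ∑ i ∈ Finset.Icc 1 j, (η * inner ℝ (P (ftrlCenter η g (x 1) i)) (g i)
        - η ^ 2 / 4 * ‖g i‖ ^ 2) := by
    rw [← Finset.sum_add_distrib]
    refine Finset.sum_le_sum fun m _ => ?_
    have := real_inner_le_norm (x m - P (ftrlCenter η g (x 1) m)) (g m)
    rw [inner_sub_left] at this
    nlinarith
  rw [htel]
  nlinarith [sq_nonneg ‖x (j + 1) - P (ftrlCenter η g (x 1) (j + 1))‖]

/-- The stopping gap, tested at the leader, controls the distance to it; this is how `ε` enters the
regret. -/
theorem sq_norm_sub_proj_le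
    (hPS : ∀ a, P a ∈ S) (hP : ∀ a, ∀ w ∈ S, inner ℝ (a - P a) (w - P a) ≤ 0)
    {ε : ℝ} {a q : E n} (hq : q ∈ S)
    (hgap : ∀ p ∈ S, inner ℝ ((2 : ℝ) • (q - a)) (q - p) ≤ ε) : ‖q - P a‖ ^ 2 ≤ ε := by
  have h1 := hgap (P a) (hPS a)
  have h2 := hP a q hq
  have h3 : inner ℝ ((2 : ℝ) • (q - a)) (q - P a) =
      2 * ‖q - P a‖ ^ 2 - 2 * inner ℝ (a - P a) (q - P a) := by
    have : q - a = (q - P a) - (a - P a) := by abel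
    rw [real_inner_smul_left, this, inner_sub_left, real_inner_self_eq_norm_sq]
    ring
  nlinarith [sq_nonneg ‖q - P a‖]

theorem norm_proj_ftrlCenter_succ_sub_le (hη : 0 ≤ η) (hPL : LipschitzWith 1 P) {m : ℕ}
    (hm : 1 ≤ m) :
    ‖P (ftrlCenter η g x₁ m) - P (ftrlCenter η g x₁ (m + 1))‖ ≤ η / 2 * ‖g m‖ := by
  have h := hPL.dist_le_mul (ftrlCenter η g x₁ m) (ftrlCenter η g x₁ (m + 1))
  rw [dist_eq_norm, dist_eq_norm, ftrlCenter_succ hm, sub_sub_cancel, norm_smul, Real.norm_eq_abs,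
    abs_of_nonneg (by positivity), NNReal.coe_one, one_mul] at h
  rwa [ftrlCenter_succ hm]

end FollowTheLeader

/-! ### Standing assumptions and block indexing. -/

/-- The assumptions on the feasible set, the losses and the smoothing parameter. -/
structure LossBounds {n : ℕ} (T : ℕ) (S : Set (E n)) (r R G M δ : ℝ) (f : ℕ → E n → ℝ) :
    Prop where
  r_pos : 0 < r
  δ_pos : 0 < δ
  δ_le : δ ≤ r
  R_pos : 0 < R
  G_pos : 0 < G
  M_pos : 0 < M
  convex_set : Convex ℝ S
  compact_set : IsCompact S
  ball_subset : Metric.closedBall 0 r ⊆ S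
  subset_ball : S ⊆ Metric.closedBall 0 R
  convex_loss : ∀ t ∈ Finset.Icc 1 T, ConvexOn ℝ univ (f t)
  lipschitz_loss : ∀ t ∈ Finset.Icc 1 T, ∀ a ∈ S, ∀ b ∈ S, |f t a - f t b| ≤ G * ‖a - b‖
  bound_loss : ∀ t ∈ Finset.Icc 1 T, ∀ a ∈ S, |f t a| ≤ M

namespace LossBounds

variable {n T : ℕ} {S : Set (E n)} {r R G M δ : ℝ} {f : ℕ → E n → ℝ}

theorem continuous_loss (hB : LossBounds T S r R G M δ f) {t : ℕ} (ht : t ∈ Finset.Icc 1 T) :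
    Continuous (f t) :=
  continuousOn_univ.1 ((hB.convex_loss t ht).continuousOn isOpen_univ)

theorem closedBall_subset (hB : LossBounds T S r R G M δ f) {x : E n} (hx : x ∈ shrunk S r δ) :
    Metric.closedBall x δ ⊆ S :=
  closedBall_subset_of_mem_shrunk hB.convex_set hB.ball_subset hB.r_pos hB.δ_pos hB.δ_le hx

theorem shrunk_subset (hB : LossBounds T S r R G M δ f) : shrunk S r δ ⊆ S := fun _ hx =>
  hB.closedBall_subset hx (Metric.mem_closedBall_self hB.δ_pos.le)

theorem norm_le (hB : LossBounds T S r R G M δ f) {x : E n} (hx : x ∈ S) : ‖x‖ ≤ R := by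
  simpa using hB.subset_ball hx

theorem norm_sub_le_of_mem (hB : LossBounds T S r R G M δ f) {x y : E n} (hx : x ∈ S)
    (hy : y ∈ S) : ‖x - y‖ ≤ 2 * R :=
  (norm_sub_le _ _).trans (by linarith [hB.norm_le hx, hB.norm_le hy])

theorem norm_sphereGrad_le [NeZero n] (hB : LossBounds T S r R G M δ f) {t : ℕ}
    (ht : t ∈ Finset.Icc 1 T) {x : E n} (hx : x ∈ shrunk S r δ) :
    ‖sphereGrad (f t) δ x‖ ≤ G :=
  BlockBandit.norm_sphereGrad_le (hB.continuous_loss ht) hB.δ_pos hB.G_pos.le fun a ha b hb =>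
    hB.lipschitz_loss t ht a (hB.closedBall_subset hx ha) b (hB.closedBall_subset hx hb)

theorem convex_shrunk (hB : LossBounds T S r R G M δ f) : Convex ℝ (shrunk S r δ) :=
  hB.convex_set.smul _

theorem isClosed_shrunk (hB : LossBounds T S r R G M δ f) : IsClosed (shrunk S r δ) :=
  (hB.compact_set.smul (1 - δ / r)).isClosed

end LossBounds

theorem measurable_sphereGrad {n : ℕ} [NeZero n] {f : E n → ℝ} (hf : Continuous f) (δ : ℝ) :
    Measurable (sphereGrad f δ) := by
  have h : Continuous (fun p : E n × E n => ((n : ℝ) / δ * f (p.1 + δ • p.2)) • p.2) := by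
    fun_prop
  exact (h.stronglyMeasurable.integral_prod_right (ν := uniformSphere n)).measurable

theorem sum_Icc_mul_eq_sum_blocks (a : ℕ → ℝ) (K N : ℕ) :
    ∑ t ∈ Finset.Icc 1 (N * K), a t =
      ∑ m ∈ Finset.Icc 1 N, ∑ s ∈ Finset.Icc 1 K, a ((m - 1) * K + s) := by
  induction N with
  | zero => simp
  | succ N ih =>
    rw [Finset.sum_Icc_succ_top (by omega), ← ih, Nat.add_sub_cancel, Nat.succ_mul]
    clear ih
    generalize N * K = L
    induction K with
    | zero => simp
    | succ K ih' =>
      have h : L + (K + 1) = L + K + 1 := rfl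
      rw [h, Finset.sum_Icc_succ_top (by omega : 1 ≤ L + K + 1), ih',
        Finset.sum_Icc_succ_top (by omega : 1 ≤ K + 1), add_assoc, h]

theorem block_round {K m s T : ℕ} (hT : T = K * K) (hm : m ∈ Finset.Icc 1 K)
    (hs : s ∈ Finset.Icc 1 K) :
    (m - 1) * K + s ∈ Finset.Icc 1 T ∧ ((m - 1) * K + s - 1) / K = m - 1 := by
  rw [Finset.mem_Icc] at *
  obtain ⟨m, rfl⟩ := Nat.exists_eq_add_of_le' hm.1
  obtain ⟨s, rfl⟩ := Nat.exists_eq_add_of_le' hs.1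
  refine ⟨⟨by omega, ?_⟩, ?_⟩
  · have : (m + 1) * K ≤ K * K := Nat.mul_le_mul_right K hm.2
    rw [hT]
    simp only [Nat.add_sub_cancel]
    linarith [hs.2]
  · simp only [Nat.add_sub_cancel]
    rw [← add_assoc, Nat.add_sub_cancel, mul_comm, Nat.mul_add_div (by omega),
      Nat.div_eq_of_lt (by omega), add_zero]

/-! ### Measurability and pathwise properties of a run. -/

namespace Run

variable {Ω : Type*} [mΩ : MeasurableSpace Ω] {P : Measure Ω} {n T : ℕ} {S : Set (E n)} {r R G M : ℝ}
  {K : ℕ} {η δ ε : ℝ} {f : ℕ → E n → ℝ} (A : Run P T S r K η δ ε f)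

/-- The gradient estimate of round `t`. -/
noncomputable def grad (t : ℕ) (ω : Ω) : E n := gradEst K δ f A.x A.u t ω

/-- The gradient estimate of block `m`. -/
noncomputable def block (m : ℕ) (ω : Ω) : E n := blockGrad K δ f A.x A.u m ω

theorem ae_norm_u {t : ℕ} (ht : t ∈ Finset.Icc 1 T) : ∀ᵐ ω ∂P, ‖A.u t ω‖ = 1 := by
  have h := ae_norm_eq_one_uniformSphere n
  rw [← A.law_u t ht] at h
  exact ae_of_ae_map ((A.measurable_u t ht).mono (A.𝓕.le t) le_rfl).aemeasurable h

/-- As `(t - 1) / K * K ≤ t - 1`, the centre of the block is fixed before round `t`, hence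
independent of `u t`. -/
theorem measurable_center {t : ℕ} (ht : t ∈ Finset.Icc 1 T) :
    Measurable[A.𝓕 (t - 1)] (A.x ((t - 1) / K)) := by
  rw [Finset.mem_Icc] at ht
  exact (A.measurable_x _ (Finset.mem_Icc.2 ⟨Nat.zero_le _, Nat.div_le_div_right (by omega)⟩)).mono
    (A.𝓕.mono (Nat.div_mul_le_self _ _)) le_rfl

theorem measurable_y {t : ℕ} (ht : t ∈ Finset.Icc 1 T) : Measurable[A.𝓕 t] (A.y t) := by
  have h1 := (A.measurable_center ht).mono (A.𝓕.mono (Nat.sub_le t 1)) le_rfl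
  have h2 : Measurable[A.𝓕 t] (fun ω => δ • A.u t ω) := (A.measurable_u t ht).const_smul δ
  exact h1.add h2

theorem measurable_grad (hB : LossBounds T S r R G M δ f) {t : ℕ} (ht : t ∈ Finset.Icc 1 T) :
    Measurable[A.𝓕 t] (A.grad t) := by
  have h1 := (hB.continuous_loss ht).measurable.comp (A.measurable_y ht)
  exact (h1.const_mul ((n : ℝ) / δ)).smul (A.measurable_u t ht)

theorem measurable_block (hB : LossBounds T S r R G M δ f) (hT : T = K * K) {m : ℕ}
    (hm : m ∈ Finset.Icc 1 K) : Measurable[A.𝓕 (m * K)] (A.block m) := by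
  have h : ∀ s ∈ Finset.Icc 1 K, Measurable[A.𝓕 (m * K)] (A.grad ((m - 1) * K + s)) := ?_
  · exact Finset.measurable_fun_sum (Finset.Icc 1 K) h
  intro s hs
  refine (A.measurable_grad hB (block_round hT hm hs).1).mono (A.𝓕.mono ?_) le_rfl
  rw [Finset.mem_Icc] at hm hs
  obtain ⟨m, rfl⟩ := Nat.exists_eq_add_of_le' hm.1
  simp only [Nat.add_sub_cancel]
  linarith [hs.2]

theorem objective_eq (m : ℕ) (ω : Ω) : objective K η δ f A.x A.u m ω =
    ftrlObjective η (fun i => A.block i ω) (A.x 1 ω) m := rfl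

/-- Induction over blocks, since a run stays in the shrunk set only if it starts there. In block `1`
no run takes place, but `x 1` is itself the centre of the objective, so its gap is zero. -/
theorem cg_spec (hB : LossBounds T S r R G M δ f) (hT : T = K * K)
    (hε : ε = 16 * R ^ 2 / K) (ω : Ω) {m : ℕ} (hm : m ∈ Finset.Icc 1 K) :
    A.x m ω ∈ shrunk S r δ ∧
      (∀ p ∈ shrunk S r δ, inner ℝ ((2 : ℝ) • (A.x m ω -
        ftrlCenter η (fun i => A.block i ω) (A.x 1 ω) m)) (A.x m ω - p) ≤ ε) ∧
      (2 ≤ m → ∃ L : ℕ, L ≤ 2 * K ∧ A.oracleCalls m ω ≤ L ∧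
        ((L : ℝ) - 1) * (16 * R ^ 2 / K ^ 2) ≤
          ftrlObjective η (fun i => A.block i ω) (A.x 1 ω) m (A.x (m - 1) ω) -
            ftrlObjective η (fun i => A.block i ω) (A.x 1 ω) m (A.x m ω)) := by
  rw [Finset.mem_Icc] at hm
  obtain ⟨m, rfl⟩ := Nat.exists_eq_add_of_le' hm.1
  induction m with
  | zero =>
    have h1 : A.x 1 ω ∈ shrunk S r δ := by rw [A.x_one]; exact A.x_zero_mem ω
    refine ⟨h1, fun p hp => ?_, fun h => by omega⟩
    rw [zero_add, ftrlCenter_one, sub_self, smul_zero, inner_zero_left, hε]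
    positivity
  | succ m ih =>
    have hKT : T / K = K := by rw [hT]; exact Nat.mul_div_cancel _ (by omega)
    have hprev := (ih (by omega)).1
    have hrun := A.cg (m + 1 + 1) (by rw [Finset.mem_Icc, hKT]; omega) ω
    rw [objective_eq] at hrun
    obtain ⟨L, hL, hcalls, hmem, hdec, hgap⟩ := hrun.exists_iterations (ftrlObjective_eq _)
      hB.convex_shrunk hprev (hB.shrunk_subset.trans hB.subset_ball) hB.R_pos (by omega) hε
    refine ⟨hmem, hgap, fun _ => ⟨L, hL, ?_, hdec⟩⟩
    rw [oracleCalls, if_pos (by omega), objective_eq]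
    exact hcalls

theorem x_mem (hB : LossBounds T S r R G M δ f) (hT : T = K * K)
    (hε : ε = 16 * R ^ 2 / K) (ω : Ω) {m : ℕ} (hm : m ≤ K) : A.x m ω ∈ shrunk S r δ := by
  rcases Nat.eq_zero_or_pos m with rfl | h
  · exact A.x_zero_mem ω
  · exact (A.cg_spec hB hT hε ω (Finset.mem_Icc.2 ⟨h, hm⟩)).1

theorem center_mem (hB : LossBounds T S r R G M δ f) (hT : T = K * K)
    (hε : ε = 16 * R ^ 2 / K) (ω : Ω) {t : ℕ} (ht : t ∈ Finset.Icc 1 T) :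
    A.x ((t - 1) / K) ω ∈ shrunk S r δ := by
  refine A.x_mem hB hT hε ω ?_
  rw [Finset.mem_Icc] at ht
  refine Nat.div_le_of_le_mul ?_
  omega

theorem ae_y_mem (hB : LossBounds T S r R G M δ f) {t : ℕ} (ht : t ∈ Finset.Icc 1 T) :
    ∀ᵐ ω ∂P, A.y t ω ∈ Metric.closedBall (A.x ((t - 1) / K) ω) δ := by
  filter_upwards [A.ae_norm_u ht] with ω hω
  rw [mem_closedBall_iff_norm, y, play, add_sub_cancel_left, norm_smul, hω, mul_one,
    Real.norm_eq_abs, abs_of_pos hB.δ_pos]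

theorem integrable_loss [IsProbabilityMeasure P] (hB : LossBounds T S r R G M δ f) (hT : T = K * K)
    (hε : ε = 16 * R ^ 2 / K) {t : ℕ} (ht : t ∈ Finset.Icc 1 T) :
    Integrable (fun ω => f t (A.y t ω)) P := by
  refine Integrable.of_bound (C := M) ((hB.continuous_loss ht).measurable.comp
    ((A.measurable_y ht).mono (A.𝓕.le t) le_rfl)).aestronglyMeasurable ?_
  filter_upwards [A.ae_y_mem hB ht] with ω hω
  exact hB.bound_loss t ht _ (hB.closedBall_subset (A.center_mem hB hT hε ω ht) hω)

theorem ae_norm_grad_le (hB : LossBounds T S r R G M δ f) (hT : T = K * K)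
    (hε : ε = 16 * R ^ 2 / K) {t : ℕ} (ht : t ∈ Finset.Icc 1 T) :
    ∀ᵐ ω ∂P, ‖A.grad t ω‖ ≤ n * M / δ := by
  filter_upwards [A.ae_y_mem hB ht, A.ae_norm_u ht] with ω hω hu
  have h := hB.bound_loss t ht _ (hB.closedBall_subset (A.center_mem hB hT hε ω ht) hω)
  have hδ := hB.δ_pos
  rw [grad, gradEst, norm_smul, hu, mul_one, norm_mul, Real.norm_eq_abs, Real.norm_eq_abs,
    abs_of_nonneg (by positivity : 0 ≤ (n : ℝ) / δ), mul_div_right_comm]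
  exact mul_le_mul_of_nonneg_left h (by positivity)

/-! ### Conditional means and second moments of the estimates. -/

/-- Conditionally on the past, the mean of the gradient estimate is `sphereGrad`. -/
theorem integral_inner_grad [IsProbabilityMeasure P] [NeZero n] (hB : LossBounds T S r R G M δ f) (hT : T = K * K)
    (hε : ε = 16 * R ^ 2 / K) {t : ℕ} (ht : t ∈ Finset.Icc 1 T) {Y : Ω → E n}
    (hY : Measurable[A.𝓕 (t - 1)] Y) {C : ℝ} (hC : ∀ᵐ ω ∂P, ‖Y ω‖ ≤ C) :
    ∫ ω, inner ℝ (A.grad t ω) (Y ω) ∂P =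
      ∫ ω, inner ℝ (sphereGrad (f t) δ (A.x ((t - 1) / K) ω)) (Y ω) ∂P := by
  have hf := hB.continuous_loss ht
  let X : Ω → E n × E n := fun ω => (A.x ((t - 1) / K) ω, Y ω)
  have hX' : Measurable[A.𝓕 (t - 1)] X := (A.measurable_center ht).prodMk hY
  have hX : Measurable X := hX'.mono (A.𝓕.le _) le_rfl
  have hu : Measurable (A.u t) := (A.measurable_u t ht).mono (A.𝓕.le _) le_rfl
  -- The pair of centre and `Y` is known before round `t`, so its joint law with `u t` is a product
  -- and Fubini integrates `u t` out first.
  have hind : IndepFun X (A.u t) P := by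
    rw [IndepFun_iff_Indep]
    exact indep_of_indep_of_le_left (A.indep_u t ht).symm hX'.comap_le
  have hmap := hind.map_prod_eq_prod_map_map hX.aemeasurable hu.aemeasurable
  rw [A.law_u t ht] at hmap
  let H : (E n × E n) × E n → ℝ := fun q =>
    (n : ℝ) / δ * f t (q.1.1 + δ • q.2) * inner ℝ q.2 q.1.2
  have hH : Continuous H := by fun_prop
  have hHg : ∀ ω, H (X ω, A.u t ω) = inner ℝ (A.grad t ω) (Y ω) := fun ω => by
    simp only [H, X, grad, gradEst, play, real_inner_smul_left]
  have : IsProbabilityMeasure (P.map X) := Measure.isProbabilityMeasure_map hX.aemeasurable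
  have hint : Integrable H ((P.map X).prod (uniformSphere n)) := by
    rw [← hmap, integrable_map_measure hH.aestronglyMeasurable (hX.prodMk hu).aemeasurable]
    refine Integrable.of_bound (C := n * M / δ * C)
      (hH.measurable.comp (hX.prodMk hu)).aestronglyMeasurable ?_
    filter_upwards [A.ae_norm_grad_le hB hT hε ht, hC] with ω h1 h2
    simp only [Function.comp_apply, hHg]
    exact (norm_inner_le_norm _ _).trans
      (mul_le_mul h1 h2 (norm_nonneg _) ((norm_nonneg _).trans h1))
  calc ∫ ω, inner ℝ (A.grad t ω) (Y ω) ∂P = ∫ ω, H (X ω, A.u t ω) ∂P := by simp_rw [hHg]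
    _ = ∫ q, H q ∂((P.map X).prod (uniformSphere n)) := by
        rw [← hmap, integral_map (hX.prodMk hu).aemeasurable hH.aestronglyMeasurable]
    _ = ∫ a, ∫ w, H (a, w) ∂(uniformSphere n) ∂(P.map X) := integral_prod _ hint
    _ = ∫ ω, ∫ w, H (X ω, w) ∂(uniformSphere n) ∂P :=
        integral_map hX.aemeasurable
          (hH.stronglyMeasurable.integral_prod_right (ν := uniformSphere n)).aestronglyMeasurable
    _ = _ := by simp_rw [inner_sphereGrad hf]; rfl

theorem integrable_inner [IsProbabilityMeasure P] {X Y : Ω → E n} (hX : Measurable X)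
    (hY : Measurable Y) {C D : ℝ} (hC : ∀ᵐ ω ∂P, ‖X ω‖ ≤ C) (hD : ∀ᵐ ω ∂P, ‖Y ω‖ ≤ D) :
    Integrable (fun ω => (inner ℝ (X ω) (Y ω) : ℝ)) P := by
  refine Integrable.of_bound (C := C * D) (hX.inner hY).aestronglyMeasurable ?_
  filter_upwards [hC, hD] with ω h1 h2
  exact (norm_inner_le_norm _ _).trans
    (mul_le_mul h1 h2 (norm_nonneg _) ((norm_nonneg _).trans h1))

theorem measurable_grad' (hB : LossBounds T S r R G M δ f) {t : ℕ} (ht : t ∈ Finset.Icc 1 T) :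
    Measurable (A.grad t) := (A.measurable_grad hB ht).mono (A.𝓕.le _) le_rfl

theorem measurable_block' (hB : LossBounds T S r R G M δ f) (hT : T = K * K) {m : ℕ}
    (hm : m ∈ Finset.Icc 1 K) : Measurable (A.block m) :=
  (A.measurable_block hB hT hm).mono (A.𝓕.le _) le_rfl

theorem block_eq_sum (m : ℕ) (ω : Ω) :
    A.block m ω = ∑ s ∈ Finset.Icc 1 K, A.grad ((m - 1) * K + s) ω := rfl

theorem ae_norm_block_le (hB : LossBounds T S r R G M δ f) (hT : T = K * K)
    (hε : ε = 16 * R ^ 2 / K) {m : ℕ} (hm : m ∈ Finset.Icc 1 K) :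
    ∀ᵐ ω ∂P, ‖A.block m ω‖ ≤ K * (n * M / δ) := by
  have h : ∀ᵐ ω ∂P, ∀ s ∈ Finset.Icc 1 K, ‖A.grad ((m - 1) * K + s) ω‖ ≤ n * M / δ := by
    rw [Finset.eventually_all]
    exact fun s hs => A.ae_norm_grad_le hB hT hε (block_round hT hm hs).1
  filter_upwards [h] with ω hω
  rw [block_eq_sum]
  refine (norm_sum_le_of_le _ hω).trans_eq ?_
  simp

/-- Unbiasedness is used twice, first for the later round and then for the earlier one. The second
use is possible because both rounds share a centre known before the earlier round. -/
theorem integral_inner_grad_grad_le [IsProbabilityMeasure P] [NeZero n]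
    (hB : LossBounds T S r R G M δ f) (hT : T = K * K) (hε : ε = 16 * R ^ 2 / K) {m : ℕ}
    (hm : m ∈ Finset.Icc 1 K) {s s' : ℕ} (hs : s ∈ Finset.Icc 1 K) (hs' : s' ∈ Finset.Icc 1 K)
    (hss : s < s') :
    ∫ ω, inner ℝ (A.grad ((m - 1) * K + s') ω) (A.grad ((m - 1) * K + s) ω) ∂P ≤ G ^ 2 := by
  obtain ⟨ht, hd⟩ := block_round hT hm hs
  obtain ⟨ht', hd'⟩ := block_round hT hm hs'
  set t := (m - 1) * K + s
  set t' := (m - 1) * K + s' with ht'def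
  have htt : t ≤ t' - 1 := by omega
  rw [A.integral_inner_grad hB hT hε ht' ((A.measurable_grad hB ht).mono (A.𝓕.mono htt) le_rfl)
    (A.ae_norm_grad_le hB hT hε ht), hd', ← hd]
  simp_rw [real_inner_comm (A.grad t _)]
  have hmem := fun ω => A.center_mem hB hT hε ω ht
  have hmeas : ∀ τ ∈ Finset.Icc 1 T, Measurable[A.𝓕 (t - 1)] fun ω =>
      sphereGrad (f τ) δ (A.x ((t - 1) / K) ω) := fun τ hτ =>
    (measurable_sphereGrad (hB.continuous_loss hτ) δ).comp (A.measurable_center ht)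
  have hbd : ∀ τ ∈ Finset.Icc 1 T, ∀ᵐ ω ∂P, ‖sphereGrad (f τ) δ (A.x ((t - 1) / K) ω)‖ ≤ G :=
    fun τ hτ => .of_forall fun ω => hB.norm_sphereGrad_le hτ (hmem ω)
  rw [A.integral_inner_grad hB hT hε ht (hmeas t' ht') (hbd t' ht')]
  have hle : ∀ ω, (inner ℝ (sphereGrad (f t) δ (A.x ((t - 1) / K) ω))
      (sphereGrad (f t') δ (A.x ((t - 1) / K) ω)) : ℝ) ≤ G ^ 2 := fun ω => by
    rw [sq]
    exact (real_inner_le_norm _ _).trans (mul_le_mul (hB.norm_sphereGrad_le ht (hmem ω))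
      (hB.norm_sphereGrad_le ht' (hmem ω)) (norm_nonneg _) hB.G_pos.le)
  calc _ ≤ ∫ _, G ^ 2 ∂P := by
        exact integral_mono (integrable_inner ((hmeas t ht).mono (A.𝓕.le _) le_rfl)
          ((hmeas t' ht').mono (A.𝓕.le _) le_rfl) (hbd t ht) (hbd t' ht'))
          (integrable_const _) hle
    _ = G ^ 2 := by simp

theorem integral_sq_norm_block_le [IsProbabilityMeasure P] [NeZero n]
    (hB : LossBounds T S r R G M δ f) (hT : T = K * K) (hε : ε = 16 * R ^ 2 / K) {m : ℕ}
    (hm : m ∈ Finset.Icc 1 K) :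
    ∫ ω, ‖A.block m ω‖ ^ 2 ∂P ≤ K * (n * M / δ) ^ 2 + K ^ 2 * G ^ 2 := by
  have hint : ∀ s ∈ Finset.Icc 1 K, ∀ s' ∈ Finset.Icc 1 K, Integrable (fun ω =>
      (inner ℝ (A.grad ((m - 1) * K + s) ω) (A.grad ((m - 1) * K + s') ω) : ℝ)) P := by
    intro s hs s' hs'
    have h1 := (block_round hT hm hs).1
    have h2 := (block_round hT hm hs').1
    exact integrable_inner (A.measurable_grad' hB h1) (A.measurable_grad' hB h2)
      (A.ae_norm_grad_le hB hT hε h1) (A.ae_norm_grad_le hB hT hε h2)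
  have h1 : ∀ ω, ‖A.block m ω‖ ^ 2 = ∑ s ∈ Finset.Icc 1 K, ∑ s' ∈ Finset.Icc 1 K,
      inner ℝ (A.grad ((m - 1) * K + s) ω) (A.grad ((m - 1) * K + s') ω) := fun ω => by
    rw [← real_inner_self_eq_norm_sq, block_eq_sum, sum_inner]
    simp_rw [inner_sum]
  simp_rw [h1]
  rw [integral_finsetSum _ fun s hs => integrable_finsetSum _ fun s' hs' => hint s hs s' hs']
  -- The diagonal term is given a superfluous `G²` so that every row has the same bound.
  have h2 : ∀ s ∈ Finset.Icc 1 K, ∫ ω, ∑ s' ∈ Finset.Icc 1 K,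
      (inner ℝ (A.grad ((m - 1) * K + s) ω) (A.grad ((m - 1) * K + s') ω) : ℝ) ∂P ≤
      ∑ s' ∈ Finset.Icc 1 K, ((if s' = s then (n * M / δ) ^ 2 else 0) + G ^ 2) := by
    intro s hs
    rw [integral_finsetSum _ fun s' hs' => hint s hs s' hs']
    refine Finset.sum_le_sum fun s' hs' => ?_
    rcases lt_trichotomy s' s with h | h | h
    · rw [if_neg (by omega), zero_add]
      exact A.integral_inner_grad_grad_le hB hT hε hm hs' hs h
    · subst h
      rw [if_pos rfl]
      have hb : ∫ ω, (inner ℝ (A.grad ((m - 1) * K + s') ω)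
          (A.grad ((m - 1) * K + s') ω) : ℝ) ∂P ≤ ∫ _, (n * M / δ) ^ 2 ∂P := by
        refine integral_mono_ae (hint s' hs s' hs) (integrable_const _) ?_
        filter_upwards [A.ae_norm_grad_le hB hT hε (block_round hT hm hs).1] with ω hω
        rw [real_inner_self_eq_norm_sq]
        gcongr
      simp only [integral_const, probReal_univ, one_smul] at hb
      nlinarith [sq_nonneg G]
    · rw [if_neg (by omega), zero_add]
      simp_rw [real_inner_comm (A.grad ((m - 1) * K + s') _)]
      exact A.integral_inner_grad_grad_le hB hT hε hm hs hs' h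
  refine (Finset.sum_le_sum h2).trans_eq ?_
  have h3 : ∀ s ∈ Finset.Icc 1 K,
      ∑ s' ∈ Finset.Icc 1 K, ((if s' = s then (n * M / δ) ^ 2 else 0) + G ^ 2) =
      (n * M / δ) ^ 2 + K * G ^ 2 := by
    intro s hs
    rw [Finset.sum_add_distrib, Finset.sum_ite_eq' _ s, if_pos hs]
    simp
  rw [Finset.sum_congr rfl h3]
  simp
  ring

theorem integrable_sq_norm_block [IsProbabilityMeasure P] (hB : LossBounds T S r R G M δ f)
    (hT : T = K * K) (hε : ε = 16 * R ^ 2 / K) {m : ℕ} (hm : m ∈ Finset.Icc 1 K) :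
    Integrable (fun ω => ‖A.block m ω‖ ^ 2) P := by
  simp_rw [← real_inner_self_eq_norm_sq]
  exact integrable_inner (A.measurable_block' hB hT hm) (A.measurable_block' hB hT hm)
    (A.ae_norm_block_le hB hT hε hm) (A.ae_norm_block_le hB hT hε hm)

theorem integrable_norm_block [IsProbabilityMeasure P] (hB : LossBounds T S r R G M δ f)
    (hT : T = K * K) (hε : ε = 16 * R ^ 2 / K) {m : ℕ} (hm : m ∈ Finset.Icc 1 K) :
    Integrable (fun ω => ‖A.block m ω‖) P := by
  refine Integrable.of_bound (C := K * (n * M / δ))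
    (A.measurable_block' hB hT hm).norm.aestronglyMeasurable ?_
  filter_upwards [A.ae_norm_block_le hB hT hε hm] with ω hω
  rwa [norm_norm]

/-- Jensen's inequality, obtained from `y ≤ v/2 + y²/(2v)`. -/
theorem integral_norm_block_le [IsProbabilityMeasure P] (hB : LossBounds T S r R G M δ f)
    (hT : T = K * K) (hε : ε = 16 * R ^ 2 / K) {m : ℕ} (hm : m ∈ Finset.Icc 1 K) {v : ℝ}
    (hv : 0 < v) (hv2 : ∫ ω, ‖A.block m ω‖ ^ 2 ∂P ≤ v ^ 2) : ∫ ω, ‖A.block m ω‖ ∂P ≤ v := by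
  have h1 : ∫ ω, ‖A.block m ω‖ ∂P ≤ ∫ ω, (v / 2 + (2 * v)⁻¹ * ‖A.block m ω‖ ^ 2) ∂P := by
    refine integral_mono (A.integrable_norm_block hB hT hε hm)
      ((integrable_const _).add ((A.integrable_sq_norm_block hB hT hε hm).const_mul _)) fun ω => ?_
    have h2 : v / 2 + (2 * v)⁻¹ * ‖A.block m ω‖ ^ 2 - ‖A.block m ω‖ =
        (2 * v)⁻¹ * (v - ‖A.block m ω‖) ^ 2 := by
      field_simp
      ring
    have h3 : 0 ≤ (2 * v)⁻¹ * (v - ‖A.block m ω‖) ^ 2 := by positivity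
    simp only
    linarith
  rw [integral_add (integrable_const _) ((A.integrable_sq_norm_block hB hT hε hm).const_mul _),
    integral_const_mul] at h1
  simp only [integral_const, probReal_univ, one_smul] at h1
  have h2 : (2 * v)⁻¹ * ∫ ω, ‖A.block m ω‖ ^ 2 ∂P ≤ (2 * v)⁻¹ * v ^ 2 := by gcongr
  have h3 : (2 * v)⁻¹ * v ^ 2 = v / 2 := by field_simp
  linarith

/-! ### Comparison with the exact leader, and the regret. -/

theorem measurable_ftrlCenter (hB : LossBounds T S r R G M δ f) (hT : T = K * K) {m : ℕ}
    (hm : m ∈ Finset.Icc 1 K) : Measurable[A.𝓕 ((m - 1) * K)] fun ω =>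
      ftrlCenter η (fun i => A.block i ω) (A.x 1 ω) m := by
  have hx : Measurable[A.𝓕 ((m - 1) * K)] (A.x 1) := by
    rw [funext A.x_one]
    exact (A.measurable_x 0 (by simp)).mono (A.𝓕.mono (by simp)) le_rfl
  have hs : ∀ i ∈ Finset.Icc 1 (m - 1), Measurable[A.𝓕 ((m - 1) * K)] (A.block i) := by
    intro i hi
    rw [Finset.mem_Icc] at hi hm
    exact (A.measurable_block hB hT (Finset.mem_Icc.2 ⟨hi.1, by omega⟩)).mono
      (A.𝓕.mono (Nat.mul_le_mul_right K hi.2)) le_rfl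
  have h2 : Measurable[A.𝓕 ((m - 1) * K)] (fun ω => (η / 2) • ∑ i ∈ Finset.Icc 1 (m - 1),
      A.block i ω) := (Finset.measurable_fun_sum (Finset.Icc 1 (m - 1)) hs).const_smul (η / 2)
  exact hx.sub h2

theorem ftrl_leader_close (hB : LossBounds T S r R G M δ f) (hT : T = K * K)
    (hε : ε = 16 * R ^ 2 / K) {e : ℝ} (he : 0 ≤ e) (he2 : ε = e ^ 2) {Q : E n → E n}
    (hQS : ∀ a, Q a ∈ shrunk S r δ)
    (hQ : ∀ a, ∀ w ∈ shrunk S r δ, inner ℝ (a - Q a) (w - Q a) ≤ 0) (ω : Ω) {m : ℕ}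
    (hm : m ∈ Finset.Icc 1 K) :
    ‖A.x m ω - Q (ftrlCenter η (fun i => A.block i ω) (A.x 1 ω) m)‖ ≤ e := by
  obtain ⟨h1, h2, -⟩ := A.cg_spec hB hT hε ω hm
  have h3 := sq_norm_sub_proj_le hQS hQ h1 h2
  exact (abs_le_of_sq_le_sq' (h3.trans_eq he2) he).2

/-- The exact follow-the-regularised-leader iterate of block `m`, for the projection `Q`. -/
noncomputable def leader (Q : E n → E n) (m : ℕ) (ω : Ω) : E n :=
  Q (ftrlCenter η (fun i => A.block i ω) (A.x 1 ω) m)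

/-- The centre played in block `m` lags one block behind the leader: `e` to the previous leader,
then one move of the leader. `N` is the norm of the previous block estimate, and `0` for `m = 1`,
where `x 0 = x 1`. -/
theorem exists_lag_bound [IsProbabilityMeasure P] (hB : LossBounds T S r R G M δ f)
    (hT : T = K * K) (hε : ε = 16 * R ^ 2 / K) (hη : 0 ≤ η) {e : ℝ} (he : 0 ≤ e)
    (he2 : ε = e ^ 2) {Q : E n → E n} (hQS : ∀ a, Q a ∈ shrunk S r δ)
    (hQ : ∀ a, ∀ w ∈ shrunk S r δ, inner ℝ (a - Q a) (w - Q a) ≤ 0) (hQL : LipschitzWith 1 Q)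
    {v : ℝ} (hv : 0 < v)
    (hv2 : ∀ m ∈ Finset.Icc 1 K, ∫ ω, ‖A.block m ω‖ ^ 2 ∂P ≤ v ^ 2) {m : ℕ}
    (hm : m ∈ Finset.Icc 1 K) :
    ∃ N : Ω → ℝ, Integrable N P ∧ ∫ ω, N ω ∂P ≤ v ∧
      ∀ ω, ‖A.x (m - 1) ω - A.leader Q m ω‖ ≤ e + η / 2 * N ω := by
  rw [Finset.mem_Icc] at hm
  obtain ⟨m, rfl⟩ := Nat.exists_eq_add_of_le' hm.1
  rcases Nat.eq_zero_or_pos m with rfl | h0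
  · refine ⟨fun _ => 0, integrable_zero _ _ _, by simpa using hv.le, fun ω => ?_⟩
    have h1 := A.ftrl_leader_close hB hT hε he he2 hQS hQ ω (Finset.mem_Icc.2 hm)
    rw [zero_add] at h1
    simpa [leader, A.x_one ω] using h1
  · have hm' : m ∈ Finset.Icc 1 K := Finset.mem_Icc.2 ⟨h0, by omega⟩
    refine ⟨fun ω => ‖A.block m ω‖, A.integrable_norm_block hB hT hε hm',
      A.integral_norm_block_le hB hT hε hm' hv (hv2 m hm'), fun ω => ?_⟩
    have h1 := A.ftrl_leader_close hB hT hε he he2 hQS hQ ω hm'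
    have h2 := norm_proj_ftrlCenter_succ_sub_le (x₁ := A.x 1 ω) (g := fun i => A.block i ω)
      hη hQL h0
    rw [Nat.add_sub_cancel, leader]
    exact (norm_sub_le_norm_sub_add_norm_sub _ _ _).trans (add_le_add h1 h2)

theorem measurable_leader (hB : LossBounds T S r R G M δ f) (hT : T = K * K) {Q : E n → E n}
    (hQL : LipschitzWith 1 Q) {m : ℕ} (hm : m ∈ Finset.Icc 1 K) :
    Measurable[A.𝓕 ((m - 1) * K)] (A.leader Q m) :=
  hQL.continuous.measurable.comp (A.measurable_ftrlCenter hB hT hm)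

/-- The errors are `δG` for playing off the centre, `2δG` from `sub_le_inner_sphereGrad`, `GRδ/r`
for shrinking the comparator, and `G` times the lag of the centre behind the leader. -/
theorem integral_loss_sub_le [IsProbabilityMeasure P] [NeZero n] (hB : LossBounds T S r R G M δ f)
    (hT : T = K * K) (hε : ε = 16 * R ^ 2 / K) (hη : 0 ≤ η) {e : ℝ} (he : 0 ≤ e)
    (he2 : ε = e ^ 2) {Q : E n → E n} (hQS : ∀ a, Q a ∈ shrunk S r δ)
    (hQ : ∀ a, ∀ w ∈ shrunk S r δ, inner ℝ (a - Q a) (w - Q a) ≤ 0) (hQL : LipschitzWith 1 Q)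
    {v : ℝ} (hv : 0 < v)
    (hv2 : ∀ m ∈ Finset.Icc 1 K, ∫ ω, ‖A.block m ω‖ ^ 2 ∂P ≤ v ^ 2) {m s : ℕ}
    (hm : m ∈ Finset.Icc 1 K) (hs : s ∈ Finset.Icc 1 K) {q : E n} (hq : q ∈ S) :
    ∫ ω, f ((m - 1) * K + s) (A.y ((m - 1) * K + s) ω) ∂P - f ((m - 1) * K + s) q ≤
      3 * δ * G + G * R * δ / r + G * (e + η / 2 * v) +
        ∫ ω, inner ℝ (A.grad ((m - 1) * K + s) ω) (A.leader Q m ω - (1 - δ / r) • q) ∂P := by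
  obtain ⟨ht, hd⟩ := block_round hT hm hs
  obtain ⟨N, hNi, hNv, hN⟩ := A.exists_lag_bound hB hT hε hη he he2 hQS hQ hQL hv hv2 hm
  set t := (m - 1) * K + s with htdef
  set z := (1 - δ / r) • q with hz
  have hr := hB.r_pos
  have hδ := hB.δ_pos
  have hG := hB.G_pos
  have hzS : z ∈ shrunk S r δ := smul_mem_smul_set hq
  -- The leader is determined by the end of the previous block, so the estimate of round `t` is
  -- unbiased against it.
  have hle : (m - 1) * K ≤ t - 1 := by
    rw [Finset.mem_Icc] at hs
    omega
  have hY : Measurable[A.𝓕 (t - 1)] fun ω => A.leader Q m ω - z :=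
    ((A.measurable_leader hB hT hQL hm).mono (A.𝓕.mono hle) le_rfl).sub_const z
  have hYb : ∀ ω, ‖A.leader Q m ω - z‖ ≤ 2 * R := fun ω =>
    hB.norm_sub_le_of_mem (hB.shrunk_subset (hQS _)) (hB.shrunk_subset hzS)
  rw [A.integral_inner_grad hB hT hε ht hY (.of_forall hYb)]
  have hX := fun ω => A.center_mem hB hT hε ω ht
  have hDb : ∀ ω, ‖sphereGrad (f t) δ (A.x ((t - 1) / K) ω)‖ ≤ G := fun ω =>
    hB.norm_sphereGrad_le ht (hX ω)
  have hDi : Integrable (fun ω => (inner ℝ (sphereGrad (f t) δ (A.x ((t - 1) / K) ω))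
      (A.leader Q m ω - z) : ℝ)) P :=
    integrable_inner (((measurable_sphereGrad (hB.continuous_loss ht) δ).comp
      (A.measurable_center ht)).mono (A.𝓕.le _) le_rfl) (hY.mono (A.𝓕.le _) le_rfl)
      (.of_forall hDb) (.of_forall hYb)
  have hNi' : Integrable (fun ω => G * (e + η / 2 * N ω)) P :=
    ((integrable_const e).add (hNi.const_mul (η / 2))).const_mul G
  have hmono : ∫ ω, f t (A.y t ω) ∂P ≤ ∫ ω, (f t q + (3 * δ * G + G * R * δ / r) +
      G * (e + η / 2 * N ω) + inner ℝ (sphereGrad (f t) δ (A.x ((t - 1) / K) ω))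
        (A.leader Q m ω - z)) ∂P := by
    refine integral_mono_ae (A.integrable_loss hB hT hε ht)
      (((integrable_const _).add hNi').add hDi) ?_
    filter_upwards [A.ae_y_mem hB ht] with ω hω
    set X := A.x ((t - 1) / K) ω with hXdef
    have hXs := hB.closedBall_subset (hX ω)
    have h1 := (le_abs_self _).trans (hB.lipschitz_loss t ht _ (hXs hω) X
      (hXs (Metric.mem_closedBall_self hδ.le)))
    have h1' : G * ‖A.y t ω - X‖ ≤ G * δ :=
      mul_le_mul_of_nonneg_left (mem_closedBall_iff_norm.1 hω) hG.le
    have h2 := sub_le_inner_sphereGrad (hB.convex_loss t ht) hδ hG.le (hB.lipschitz_loss t ht)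
      hXs (hB.closedBall_subset hzS)
    have h3 := (le_abs_self _).trans (hB.lipschitz_loss t ht z (hB.shrunk_subset hzS) q hq)
    have h4 : ‖z - q‖ ≤ δ / r * R := by
      have : z - q = -((δ / r) • q) := by rw [hz]; module
      rw [this, norm_neg, norm_smul, Real.norm_eq_abs, abs_of_pos (by positivity)]
      exact mul_le_mul_of_nonneg_left (hB.norm_le hq) (by positivity)
    have h4' : G * ‖z - q‖ ≤ G * (δ / r * R) := mul_le_mul_of_nonneg_left h4 hG.le
    have h5 : inner ℝ (sphereGrad (f t) δ X) (X - z) =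
        inner ℝ (sphereGrad (f t) δ X) (X - A.leader Q m ω) +
        inner ℝ (sphereGrad (f t) δ X) (A.leader Q m ω - z) := by
      rw [← inner_add_right, sub_add_sub_cancel]
    have h6 : inner ℝ (sphereGrad (f t) δ X) (X - A.leader Q m ω) ≤ G * (e + η / 2 * N ω) := by
      have h7 := hN ω
      rw [← hd] at h7
      exact (real_inner_le_norm _ _).trans (mul_le_mul (hDb ω) h7 (norm_nonneg _) hG.le)
    have h8 : G * (δ / r * R) = G * R * δ / r := by ring
    linarith
  have hci : Integrable (fun ω => f t q + (3 * δ * G + G * R * δ / r) +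
      G * (e + η / 2 * N ω)) P := (integrable_const _).add hNi'
  rw [integral_add hci hDi, integral_add (integrable_const _) hNi',
    integral_const_mul, integral_add (integrable_const _) (hNi.const_mul _),
    integral_const_mul] at hmono
  simp only [integral_const, probReal_univ, one_smul] at hmono
  have h9 : G * (e + η / 2 * ∫ ω, N ω ∂P) ≤ G * (e + η / 2 * v) := by gcongr
  linarith

theorem expectedRegret_le [IsProbabilityMeasure P] [NeZero n] (hB : LossBounds T S r R G M δ f)
    (hT : T = K * K) (hε : ε = 16 * R ^ 2 / K) (hη : 0 < η) {e : ℝ} (he : 0 ≤ e)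
    (he2 : ε = e ^ 2) {v : ℝ} (hv : 0 < v)
    (hv2 : K * (n * M / δ) ^ 2 + K ^ 2 * G ^ 2 ≤ v ^ 2) :
    A.expectedRegret ≤ T * (3 * δ * G + G * R * δ / r + G * (e + η / 2 * v)) +
      (4 * R ^ 2 / η + η / 4 * (K * v ^ 2)) := by
  have hne : S.Nonempty := ⟨0, hB.ball_subset (Metric.mem_closedBall_self hB.r_pos.le)⟩
  have hcont : Continuous fun p => ∑ t ∈ Finset.Icc 1 T, f t p :=
    continuous_finsetSum _ fun t ht => hB.continuous_loss ht
  obtain ⟨q, hq, hqmin⟩ := hB.compact_set.exists_isMinOn hne hcont.continuousOn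
  have hinf : ∑ t ∈ Finset.Icc 1 T, f t q ≤
      sInf ((fun p => ∑ t ∈ Finset.Icc 1 T, f t p) '' S) := by
    refine le_csInf (hne.image _) ?_
    rintro _ ⟨p, hp, rfl⟩
    exact hqmin hp
  obtain ⟨Q, hQS, hQ, hQL⟩ := exists_proj (S := shrunk S r δ) (hne.smul_set)
    hB.isClosed_shrunk hB.convex_shrunk
  have hbl : ∀ m ∈ Finset.Icc 1 K, ∫ ω, ‖A.block m ω‖ ^ 2 ∂P ≤ v ^ 2 := fun m hm =>
    (A.integral_sq_norm_block_le hB hT hε hm).trans hv2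
  set z := (1 - δ / r) • q with hz
  have hzS : z ∈ shrunk S r δ := smul_mem_smul_set hq
  set C := 3 * δ * G + G * R * δ / r + G * (e + η / 2 * v) with hC
  have hlead : ∀ m ∈ Finset.Icc 1 K, Measurable fun ω => A.leader Q m ω - z := fun m hm =>
    ((A.measurable_leader hB hT hQL hm).mono (A.𝓕.le _) le_rfl).sub_const z
  have hleadb : ∀ m ω, ‖A.leader Q m ω - z‖ ≤ 2 * R := fun m ω =>
    hB.norm_sub_le_of_mem (hB.shrunk_subset (hQS _)) (hB.shrunk_subset hzS)
  have hbi : ∀ m ∈ Finset.Icc 1 K,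
      Integrable (fun ω => (inner ℝ (A.block m ω) (A.leader Q m ω - z) : ℝ)) P := fun m hm =>
    integrable_inner (A.measurable_block' hB hT hm) (hlead m hm)
      (A.ae_norm_block_le hB hT hε hm) (.of_forall (hleadb m))
  have hblock : ∀ m ∈ Finset.Icc 1 K, ∑ s ∈ Finset.Icc 1 K,
      (∫ ω, f ((m - 1) * K + s) (A.y ((m - 1) * K + s) ω) ∂P - f ((m - 1) * K + s) q) ≤
      K * C + ∫ ω, inner ℝ (A.block m ω) (A.leader Q m ω - z) ∂P := by
    intro m hm
    refine (Finset.sum_le_sum fun s hs => A.integral_loss_sub_le hB hT hε hη.le he he2 hQS hQ hQL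
      hv hbl hm hs hq).trans_eq ?_
    rw [Finset.sum_add_distrib, ← integral_finsetSum]
    · simp_rw [block_eq_sum, sum_inner]
      rw [Finset.sum_const, Nat.card_Icc, Nat.add_sub_cancel, nsmul_eq_mul]
    · intro s hs
      have ht := (block_round hT hm hs).1
      exact integrable_inner (A.measurable_grad' hB ht) (hlead m hm)
        (A.ae_norm_grad_le hB hT hε ht) (.of_forall (hleadb m))
  have hftrl : ∑ m ∈ Finset.Icc 1 K, ∫ ω, inner ℝ (A.block m ω) (A.leader Q m ω - z) ∂P ≤
      4 * R ^ 2 / η + η / 4 * (K * v ^ 2) := by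
    rw [← integral_finsetSum _ hbi]
    have h1 : ∫ ω, ∑ m ∈ Finset.Icc 1 K, (inner ℝ (A.block m ω) (A.leader Q m ω - z) : ℝ) ∂P ≤
        ∫ ω, (4 * R ^ 2 / η + η / 4 * ∑ m ∈ Finset.Icc 1 K, ‖A.block m ω‖ ^ 2) ∂P := by
      refine integral_mono (integrable_finsetSum _ hbi) ((integrable_const _).add
        ((integrable_finsetSum _ fun m hm =>
          A.integrable_sq_norm_block hB hT hε hm).const_mul _)) fun ω => ?_
      have h2 := ftrl_regret hQS hQ K hzS (η := η) (g := fun i => A.block i ω) (x₁ := A.x 1 ω)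
      have h3 : ‖z - A.x 1 ω‖ ≤ 2 * R := by
        refine hB.norm_sub_le_of_mem (hB.shrunk_subset hzS) (hB.shrunk_subset ?_)
        rw [A.x_one]
        exact A.x_zero_mem ω
      have h4 : ‖z - A.x 1 ω‖ ^ 2 ≤ (2 * R) ^ 2 := by gcongr
      have h5 : η * (4 * R ^ 2 / η + η / 4 * ∑ m ∈ Finset.Icc 1 K, ‖A.block m ω‖ ^ 2) =
          (2 * R) ^ 2 + η ^ 2 / 4 * ∑ m ∈ Finset.Icc 1 K, ‖A.block m ω‖ ^ 2 := by
        field_simp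
        ring
      refine le_of_mul_le_mul_left ?_ hη
      simp only
      rw [h5]
      exact h2.trans (by linarith)
    refine h1.trans ?_
    have hsi : Integrable (fun ω => ∑ m ∈ Finset.Icc 1 K, ‖A.block m ω‖ ^ 2) P :=
      integrable_finsetSum _ fun m hm => A.integrable_sq_norm_block hB hT hε hm
    rw [integral_add (integrable_const _) (hsi.const_mul _), integral_const_mul,
      integral_finsetSum _ fun m hm => A.integrable_sq_norm_block hB hT hε hm]
    simp only [integral_const, probReal_univ, one_smul]
    have h6 := Finset.sum_le_sum hbl
    simp only [Finset.sum_const, Nat.card_Icc, Nat.add_sub_cancel, nsmul_eq_mul] at h6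
    gcongr
  have hsum : ∑ t ∈ Finset.Icc 1 T, (∫ ω, f t (A.y t ω) ∂P - f t q) ≤
      T * C + (4 * R ^ 2 / η + η / 4 * (K * v ^ 2)) := by
    have h7 := sum_Icc_mul_eq_sum_blocks (fun t => ∫ ω, f t (A.y t ω) ∂P - f t q) K K
    rw [← hT] at h7
    rw [h7]
    refine (Finset.sum_le_sum hblock).trans ?_
    rw [Finset.sum_add_distrib]
    have hT' : (T : ℝ) = K * K := by rw [hT]; push_cast; rfl
    simp only [Finset.sum_const, Nat.card_Icc, Nat.add_sub_cancel, nsmul_eq_mul]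
    rw [hT', mul_assoc]
    linarith
  rw [Finset.sum_sub_distrib] at hsum
  rw [expectedRegret]
  linarith

/-! ### Counting oracle calls. -/

/-- The `K - 1` is one final iteration for each of the `K - 1` runs; all other iterations are
charged to the decrease of the objectives at the rate `16R²/K²`. -/
theorem sum_oracleCalls_le (hB : LossBounds T S r R G M δ f) (hT : T = K * K) (hK : 1 ≤ K)
    (hε : ε = 16 * R ^ 2 / K) (hη : 0 ≤ η) {e : ℝ} (he : 0 ≤ e) (he2 : ε = e ^ 2) (ω : Ω) :
    ∃ L : ℕ, ∑ m ∈ Finset.Icc 1 (T / K), A.oracleCalls m ω ≤ (L : ℕ∞) ∧ L ≤ 2 * K * K ∧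
      (L : ℝ) ≤ (K - 1) + K ^ 2 / (16 * R ^ 2) * ∑ m ∈ Finset.Icc 1 (K - 1),
        (η * e * ‖A.block m ω‖ + η ^ 2 / 4 * ‖A.block m ω‖ ^ 2) := by
  have hne : S.Nonempty := ⟨0, hB.ball_subset (Metric.mem_closedBall_self hB.r_pos.le)⟩
  obtain ⟨Q, hQS, hQ, -⟩ := exists_proj (S := shrunk S r δ) (hne.smul_set)
    hB.isClosed_shrunk hB.convex_shrunk
  have hTK : T / K = K := by rw [hT]; exact Nat.mul_div_cancel _ (by omega)
  have hspec : ∀ m, ∃ L : ℕ, m ∈ Finset.Icc 2 K → L ≤ 2 * K ∧ A.oracleCalls m ω ≤ L ∧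
        ((L : ℝ) - 1) * (16 * R ^ 2 / K ^ 2) ≤
          ftrlObjective η (fun i => A.block i ω) (A.x 1 ω) m (A.x (m - 1) ω) -
            ftrlObjective η (fun i => A.block i ω) (A.x 1 ω) m (A.x m ω) := by
    intro m
    by_cases hm : m ∈ Finset.Icc 2 K
    · have hm' := Finset.mem_Icc.1 hm
      obtain ⟨L, hL⟩ := (A.cg_spec hB hT hε ω (m := m) (Finset.mem_Icc.2 (by omega))).2.2 hm'.1
      exact ⟨L, fun _ => hL⟩
    · exact ⟨0, fun h => absurd h hm⟩
  choose L hL using hspec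
  obtain ⟨j, rfl⟩ := Nat.exists_eq_add_of_le' hK
  refine ⟨∑ m ∈ Finset.Icc 2 (j + 1), L m, ?_, ?_, ?_⟩
  · have h1 : Finset.Icc 1 (j + 1) = insert 1 (Finset.Icc 2 (j + 1)) := by
      ext i
      simp only [Finset.mem_Icc, Finset.mem_insert]
      omega
    rw [hTK, h1, Finset.sum_insert (by simp), oracleCalls, if_neg (lt_irrefl 1), zero_add]
    push_cast
    exact Finset.sum_le_sum fun m hm => (hL m hm).2.1
  · refine (Finset.sum_le_card_nsmul _ _ _ fun m hm => (hL m hm).1).trans ?_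
    simp only [Nat.card_Icc, smul_eq_mul]
    have : j + 1 + 1 - 2 ≤ j + 1 := by omega
    calc _ ≤ (j + 1) * (2 * (j + 1)) := Nat.mul_le_mul_right _ this
      _ = _ := by ring
  · have hR := hB.R_pos
    set k : ℝ := ((j + 1 : ℕ) : ℝ) with hk
    have hk0 : 0 < k := by rw [hk]; positivity
    have h1 := Finset.sum_le_sum fun m hm => (hL m hm).2.2
    rw [← Finset.sum_mul, Finset.sum_sub_distrib] at h1
    -- `ftrl_progress_le` asks for feasible points at all indices, so the iterates are frozen after
    -- the last block.
    have hxm : ∃ x : ℕ → E n, (∀ m, 1 ≤ m → x m ∈ shrunk S r δ) ∧ ∀ m ≤ j + 1, x m = A.x m ω := by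
      refine ⟨fun m => A.x (min m (j + 1)) ω, fun m _ => A.x_mem hB hT hε ω (min_le_right _ _),
        fun m hm => by simp only [min_eq_left hm]⟩
    obtain ⟨x, hxS, hx⟩ := hxm
    have h2 := ftrl_progress_le hQS hQ hη (g := fun i => A.block i ω) hxS j
    rw [hx 1 (by omega)] at h2
    have h3 : ∑ m ∈ Finset.Icc 2 (j + 1),
        (ftrlObjective η (fun i => A.block i ω) (A.x 1 ω) m (A.x (m - 1) ω) -
          ftrlObjective η (fun i => A.block i ω) (A.x 1 ω) m (A.x m ω)) ≤
        ∑ m ∈ Finset.Icc 1 j,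
          (η * e * ‖A.block m ω‖ + η ^ 2 / 4 * ‖A.block m ω‖ ^ 2) := by
      refine (Finset.sum_congr rfl fun m hm => ?_).trans_le (h2.trans
        (Finset.sum_le_sum fun m hm => ?_))
      · rw [Finset.mem_Icc] at hm
        rw [hx m hm.2, hx (m - 1) (by omega)]
      · rw [Finset.mem_Icc] at hm
        rw [hx m (by omega)]
        have h4 := A.ftrl_leader_close hB hT hε he he2 hQS hQ ω (m := m)
          (Finset.mem_Icc.2 (by omega))
        have h5 : η * (‖A.block m ω‖ * ‖A.x m ω - Q (ftrlCenter η (fun i => A.block i ω)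
            (A.x 1 ω) m)‖) ≤ η * (‖A.block m ω‖ * e) := by gcongr
        linarith
    have h6 := h1.trans h3
    rw [Nat.add_sub_cancel]
    simp only [Finset.sum_const, Nat.card_Icc, nsmul_eq_mul, mul_one] at h6
    have h7 : ((j + 1 + 1 - 2 : ℕ) : ℝ) = k - 1 := by
      rw [hk]
      have : j + 1 + 1 - 2 = j := by omega
      rw [this]
      push_cast
      ring
    rw [h7] at h6
    push_cast
    have h8 : ∑ m ∈ Finset.Icc 2 (j + 1), (L m : ℝ) - (k - 1) =
        k ^ 2 / (16 * R ^ 2) * ((∑ m ∈ Finset.Icc 2 (j + 1), (L m : ℝ) - (k - 1)) *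
          (16 * R ^ 2 / k ^ 2)) := by
      field_simp
    have h9 := mul_le_mul_of_nonneg_left h6 (by positivity : 0 ≤ k ^ 2 / (16 * R ^ 2))
    rw [← h8] at h9
    linarith

theorem expectedOracleCalls_le_two_mul [IsProbabilityMeasure P] (hB : LossBounds T S r R G M δ f)
    (hT : T = K * K) (hK : 1 ≤ K) (hε : ε = 16 * R ^ 2 / K) (hη : 0 ≤ η) {e : ℝ} (he : 0 ≤ e)
    (he2 : ε = e ^ 2) : A.expectedOracleCalls ≤ ENNReal.ofReal (2 * T) := by
  have h : ∀ ω, ((∑ m ∈ Finset.Icc 1 (T / K), A.oracleCalls m ω : ℕ∞) : ℝ≥0∞) ≤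
      ENNReal.ofReal (2 * T) := by
    intro ω
    obtain ⟨L, h1, h2, -⟩ := A.sum_oracleCalls_le hB hT hK hε hη he he2 ω
    refine (ENat.toENNReal_le.2 h1).trans ?_
    rw [ENat.toENNReal_coe, ← ENNReal.ofReal_natCast]
    refine ENNReal.ofReal_le_ofReal ?_
    rw [hT]
    have : (L : ℝ) ≤ ((2 * K * K : ℕ) : ℝ) := by exact_mod_cast h2
    push_cast at this ⊢
    linarith
  exact (lintegral_mono h).trans (by simp)

theorem expectedOracleCalls_le [IsProbabilityMeasure P] [NeZero n]
    (hB : LossBounds T S r R G M δ f)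
    (hT : T = K * K) (hK : 1 ≤ K) (hε : ε = 16 * R ^ 2 / K) (hη : 0 ≤ η) {e : ℝ} (he : 0 ≤ e)
    (he2 : ε = e ^ 2) {v : ℝ} (hv : 0 < v)
    (hv2 : K * (n * M / δ) ^ 2 + K ^ 2 * G ^ 2 ≤ v ^ 2) :
    A.expectedOracleCalls ≤ ENNReal.ofReal
      ((K - 1) * (1 + K ^ 2 / (16 * R ^ 2) * (η * e * v + η ^ 2 / 4 * v ^ 2))) := by
  have hR := hB.R_pos
  have hK' : (1 : ℝ) ≤ K := by exact_mod_cast hK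
  have hmem : ∀ m ∈ Finset.Icc 1 (K - 1), m ∈ Finset.Icc 1 K := fun m hm =>
    Finset.Icc_subset_Icc_right (Nat.sub_le K 1) hm
  let W : Ω → ℝ := fun ω => (K - 1) + K ^ 2 / (16 * R ^ 2) * ∑ m ∈ Finset.Icc 1 (K - 1),
        (η * e * ‖A.block m ω‖ + η ^ 2 / 4 * ‖A.block m ω‖ ^ 2)
  have hti : ∀ m ∈ Finset.Icc 1 (K - 1), Integrable (fun ω =>
      η * e * ‖A.block m ω‖ + η ^ 2 / 4 * ‖A.block m ω‖ ^ 2) P := fun m hm =>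
    ((A.integrable_norm_block hB hT hε (hmem m hm)).const_mul _).add
      ((A.integrable_sq_norm_block hB hT hε (hmem m hm)).const_mul _)
  have hWi : Integrable W P :=
    (integrable_const _).add ((integrable_finsetSum _ hti).const_mul _)
  have hW0 : ∀ ω, 0 ≤ W ω := fun ω => by
    have : 0 ≤ ∑ m ∈ Finset.Icc 1 (K - 1),
        (η * e * ‖A.block m ω‖ + η ^ 2 / 4 * ‖A.block m ω‖ ^ 2) :=
      Finset.sum_nonneg fun m _ => by positivity
    have h2 : 0 ≤ (K : ℝ) ^ 2 / (16 * R ^ 2) := by positivity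
    have := mul_nonneg h2 this
    simp only [W]
    linarith
  have h : ∀ ω, ((∑ m ∈ Finset.Icc 1 (T / K), A.oracleCalls m ω : ℕ∞) : ℝ≥0∞) ≤
      ENNReal.ofReal (W ω) := by
    intro ω
    obtain ⟨L, h1, -, h3⟩ := A.sum_oracleCalls_le hB hT hK hε hη he he2 ω
    refine (ENat.toENNReal_le.2 h1).trans ?_
    rw [ENat.toENNReal_coe, ← ENNReal.ofReal_natCast]
    exact ENNReal.ofReal_le_ofReal h3
  refine (lintegral_mono h).trans ?_
  rw [← ofReal_integral_eq_lintegral_ofReal hWi (.of_forall hW0)]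
  refine ENNReal.ofReal_le_ofReal ?_
  simp only [W]
  rw [integral_add (integrable_const _) ((integrable_finsetSum _ hti).const_mul _),
    integral_const_mul, integral_finsetSum _ hti]
  simp only [integral_const, probReal_univ, one_smul]
  have hterm : ∀ m ∈ Finset.Icc 1 (K - 1),
      ∫ ω, (η * e * ‖A.block m ω‖ + η ^ 2 / 4 * ‖A.block m ω‖ ^ 2) ∂P ≤
        η * e * v + η ^ 2 / 4 * v ^ 2 := by
    intro m hm
    have hm' := hmem m hm
    have h2 := (A.integral_sq_norm_block_le hB hT hε hm').trans hv2
    have h1 := A.integral_norm_block_le hB hT hε hm' hv h2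
    rw [integral_add ((A.integrable_norm_block hB hT hε hm').const_mul _)
      ((A.integrable_sq_norm_block hB hT hε hm').const_mul _), integral_const_mul,
      integral_const_mul]
    gcongr
  have hs := Finset.sum_le_sum hterm
  simp only [Finset.sum_const, Nat.card_Icc, Nat.add_sub_cancel, nsmul_eq_mul] at hs
  rw [Nat.cast_sub hK, Nat.cast_one] at hs
  have h2 : 0 ≤ (K : ℝ) ^ 2 / (16 * R ^ 2) := by positivity
  have h3 := mul_le_mul_of_nonneg_left hs h2
  linarith

/-! ### Substituting the parameters, as powers of `q = T^{1/4}`. -/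

theorem bounds_of_parameters [IsProbabilityMeasure P] [NeZero n]
    (hB : LossBounds T S r R G M δ f) {q c : ℝ} (hq : 1 ≤ q) (hc : 0 < c) (hK : (K : ℝ) = q ^ 2)
    (hT : T = K * K) (hη : η = 2 * c * R / (n * M) * (q ^ 3)⁻¹) (hδ : δ = c * q⁻¹)
    (hε : ε = 16 * R ^ 2 * (q ^ 2)⁻¹) :
    (∀ t ∈ Finset.Icc 1 T, Integrable (fun ω => f t (A.y t ω)) P) ∧
    A.expectedRegret ≤
      (3 * c * G + c * R * G / r + 6 * G * R + 4 * (c * G ^ 2 * R / (n * M))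
        + 4 * (R * n * M / c)) * q ^ 3 ∧
    A.expectedOracleCalls ≤ ENNReal.ofReal ((3 / 4 + G * c / (n * M) / 2
        + (G * c / (n * M)) ^ 2 / 16) * T) ∧
    A.expectedOracleCalls ≤ ENNReal.ofReal (2 * T) := by
  have hR := hB.R_pos
  have hG := hB.G_pos
  have hr := hB.r_pos
  have hn : (0 : ℝ) < n := Nat.cast_pos.2 (Nat.pos_of_neZero n)
  have hN : 0 < n * M := mul_pos hn hB.M_pos
  have hq0 : 0 < q := by linarith
  have hK1 : 1 ≤ K := by
    have : (1 : ℝ) ≤ K := by rw [hK]; exact one_le_pow₀ hq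
    exact_mod_cast this
  have hTq : (T : ℝ) = q ^ 4 := by rw [hT]; push_cast; rw [hK]; ring
  have hε' : ε = 16 * R ^ 2 / K := by rw [hε, hK]; rfl
  have hη0 : 0 < η := by rw [hη]; positivity
  have he2 : ε = (4 * R / q) ^ 2 := by rw [hε]; field_simp; ring
  set N := n * M with hNdef
  -- With these parameters the second-moment bound of a block is exactly `(q² w)²`.
  set w := √((N / c) ^ 2 + G ^ 2) with hw
  have hw2 : w ^ 2 = (N / c) ^ 2 + G ^ 2 := Real.sq_sqrt (by positivity)
  have hw0 : 0 < w := Real.sqrt_pos.2 (by positivity)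
  have hv2 : K * (N / δ) ^ 2 + K ^ 2 * G ^ 2 ≤ (q ^ 2 * w) ^ 2 := by
    rw [hK, hδ, mul_pow, hw2]
    refine le_of_eq ?_
    field_simp
  have hv : 0 < q ^ 2 * w := by positivity
  have he : 0 ≤ 4 * R / q := by positivity
  refine ⟨fun t ht => A.integrable_loss hB hT hε' ht, ?_, ?_,
    A.expectedOracleCalls_le_two_mul hB hT hK1 hε' hη0.le he he2⟩
  · refine (A.expectedRegret_le hB hT hε' hη0 he he2 hv hv2).trans ?_
    have h1 : T * (3 * δ * G + G * R * δ / r + G * (4 * R / q + η / 2 * (q ^ 2 * w))) +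
        (4 * R ^ 2 / η + η / 4 * (K * (q ^ 2 * w) ^ 2)) =
        (3 * c * G + c * R * G / r + 4 * G * R + c * R / N * (G * w) + 2 * (R * N / c) +
          c * R / (2 * N) * w ^ 2) * q ^ 3 := by
      rw [hTq, hη, hδ, hK]
      field_simp
      ring
    rw [h1]
    refine mul_le_mul_of_nonneg_right ?_ (by positivity)
    -- This leaves coefficients `4`, `3/2` and `3` on `GR`, `cG²R/N` and `RN/c`, within the stated
    -- `6`, `4` and `4`.
    have h2 : G * w ≤ (G ^ 2 + w ^ 2) / 2 := by nlinarith [sq_nonneg (G - w)]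
    have h3 : c * R / N * (G * w) ≤ c * R / N * ((G ^ 2 + w ^ 2) / 2) :=
      mul_le_mul_of_nonneg_left h2 (by positivity)
    have h4 : c * R / N * ((G ^ 2 + w ^ 2) / 2) + c * R / (2 * N) * w ^ 2 =
        3 / 2 * (c * G ^ 2 * R / N) + R * N / c := by
      rw [hw2]
      field_simp
      ring
    have h5 : R * n * M / c = R * N / c := by rw [hNdef]; ring
    have h6 : 0 ≤ c * G ^ 2 * R / N := by positivity
    have h7 : 0 ≤ R * N / c := by positivity
    have h8 : 0 ≤ G * R := by positivity
    rw [h5]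
    linarith
  · refine (A.expectedOracleCalls_le hB hT hK1 hε' hη0.le he he2 hv hv2).trans
      (ENNReal.ofReal_le_ofReal ?_)
    set a := G * c / N with ha
    have ha0 : 0 < a := by positivity
    set ρ := c * w / N with hρ
    have hρ0 : 0 < ρ := by positivity
    have hρ2 : ρ ^ 2 = 1 + a ^ 2 := by
      rw [hρ, ha, div_pow, mul_pow, hw2]
      field_simp
    have hρ1 : ρ ≤ 1 + a := by
      refine (abs_le_of_sq_le_sq' ?_ (by positivity)).2
      linarith [add_sq 1 a]
    have h1 : (K : ℝ) ^ 2 / (16 * R ^ 2) * (η * (4 * R / q) * (q ^ 2 * w) +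
        η ^ 2 / 4 * (q ^ 2 * w) ^ 2) = K * (ρ / 2 + ρ ^ 2 / 16) := by
      rw [hη, hK, hρ]
      field_simp
      ring
    rw [h1]
    have hT' : (T : ℝ) = K ^ 2 := by rw [hTq, hK]; ring
    rw [hT', hρ2]
    have hk : (1 : ℝ) ≤ K := by exact_mod_cast hK1
    generalize (K : ℝ) = k at hk
    have h2 : (k - 1) * (1 + k * (ρ / 2 + (1 + a ^ 2) / 16)) ≤
        (k - 1) * (1 + k * ((1 + a) / 2 + (1 + a ^ 2) / 16)) := by
      have : k * (ρ / 2) ≤ k * ((1 + a) / 2) := mul_le_mul_of_nonneg_left (by linarith) (by linarith)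
      exact mul_le_mul_of_nonneg_left (by linarith) (by linarith)
    refine h2.trans ?_
    have h3 : 0 ≤ k * (a / 2 + a ^ 2 / 16) := by positivity
    have h4 : (k - 1) * (1 + k * ((1 + a) / 2 + (1 + a ^ 2) / 16)) =
        (k - 1) * (1 + 9 / 16 * k) + (a / 2 + a ^ 2 / 16) * k ^ 2 - k * (a / 2 + a ^ 2 / 16) := by
      ring
    -- The `9/16` is `1/2 + 1/16`, from `ρ/2 + ρ²/16` with `ρ ≤ 1 + a` and `ρ² = 1 + a²`.
    have h5 : (k - 1) * (1 + 9 / 16 * k) ≤ 3 / 4 * k ^ 2 := by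
      linarith [sq_nonneg (k - 7 / 6), sq_nonneg k]
    linarith

end Run

end BlockBandit

/-! ### The main theorem. -/

theorem theorem1 {Ω : Type*} [MeasurableSpace Ω] (P : Measure Ω) [IsProbabilityMeasure P]
    (n T K : ℕ) (hn : 1 ≤ n) (hT : 1 ≤ T) (hK : (K : ℝ) = (T : ℝ) ^ (1 / 2 : ℝ))
    (r R G M : ℝ) (hr : 0 < r) (hR : 0 < R) (hG : 0 < G) (hM : 0 < M)
    (S : Set (BlockBandit.E n)) (hS_compact : IsCompact S) (hS_convex : Convex ℝ S)
    (hrS : Metric.closedBall 0 r ⊆ S) (hSR : S ⊆ Metric.closedBall 0 R)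
    (f : ℕ → BlockBandit.E n → ℝ)
    (hf_convex : ∀ t ∈ Finset.Icc 1 T, ConvexOn ℝ Set.univ (f t))
    (hf_subgrad : ∀ t ∈ Finset.Icc 1 T, ∀ x ∈ S, ∀ g ∈ BlockBandit.subdifferential (f t) x,
      ‖g‖ ≤ G)
    (hf_bound : ∀ t ∈ Finset.Icc 1 T, ∀ x ∈ S, |f t x| ≤ M) :
    (∀ c : ℝ, 0 < c → c * (T : ℝ) ^ (-(1 / 4) : ℝ) / r ≤ 1 →
      ∀ A : BlockBandit.Run P T S r K
          (2 * c * R / (n * M) * (T : ℝ) ^ (-(3 / 4) : ℝ)) (c * (T : ℝ) ^ (-(1 / 4) : ℝ))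
          (16 * R ^ 2 * (T : ℝ) ^ (-(1 / 2) : ℝ)) f,
        (∀ t ∈ Finset.Icc 1 T, Integrable (fun ω => f t (A.y t ω)) P) ∧
        A.expectedRegret ≤
          (3 * c * G + c * R * G / r + 6 * G * R + 4 * (c * G ^ 2 * R / (n * M))
            + 4 * (R * n * M / c)) * (T : ℝ) ^ (3 / 4 : ℝ) ∧
        A.expectedOracleCalls ≤
          ENNReal.ofReal ((3 / 4 + G * c / (2 * n * M)
            + G ^ 2 * c ^ 2 / (4 * n ^ 2 * M ^ 2)) * T)) ∧
    ((n * M / (G * r)) ^ 2 ≤ (T : ℝ) →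
      ∀ c : ℝ, c = √(n * M * r / G) →
      ∀ A : BlockBandit.Run P T S r K
          (2 * c * R / (n * M) * (T : ℝ) ^ (-(3 / 4) : ℝ)) (c * (T : ℝ) ^ (-(1 / 4) : ℝ))
          (16 * R ^ 2 * (T : ℝ) ^ (-(1 / 2) : ℝ)) f,
        (∀ t ∈ Finset.Icc 1 T, Integrable (fun ω => f t (A.y t ω)) P) ∧
        A.expectedRegret ≤
          (8 * (R / r) * √(n * M * r * G) + 6 * G * R
            + 4 * G * R * √(r * G / (n * M))) * (T : ℝ) ^ (3 / 4 : ℝ) ∧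
        A.expectedOracleCalls ≤
          ENNReal.ofReal ((3 / 4 + 1 / 2 * √(G * r / (n * M))
            + 1 / 4 * √(G * r / (n * M))) * T)) := by

  have : NeZero n := ⟨by omega⟩
  have hT0 : (0 : ℝ) < T := by exact_mod_cast hT
  have hT1 : (1 : ℝ) ≤ T := by exact_mod_cast hT
  set q : ℝ := (T : ℝ) ^ (1 / 4 : ℝ) with hq
  have hq1 : 1 ≤ q := Real.one_le_rpow hT1 (by norm_num)
  have hq0 : 0 < q := by linarith
  have hpow : ∀ j : ℕ, (T : ℝ) ^ ((j : ℝ) / 4) = q ^ j := fun j => by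
    rw [hq, ← Real.rpow_mul_natCast hT0.le]
    congr 1
    ring
  have hKq : (K : ℝ) = q ^ 2 := by rw [hK, ← hpow 2]; norm_num
  have hTK : T = K * K := by
    have : (T : ℝ) = ((K * K : ℕ) : ℝ) := by
      push_cast
      rw [hKq, ← pow_add, ← hpow]
      norm_num
    exact_mod_cast this
  have h34 : (T : ℝ) ^ (3 / 4 : ℝ) = q ^ 3 := by rw [← hpow 3]; norm_num
  have hm34 : (T : ℝ) ^ (-(3 / 4) : ℝ) = (q ^ 3)⁻¹ := by rw [Real.rpow_neg hT0.le, h34]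
  have hm14 : (T : ℝ) ^ (-(1 / 4) : ℝ) = q⁻¹ := by rw [Real.rpow_neg hT0.le]
  have hm12 : (T : ℝ) ^ (-(1 / 2) : ℝ) = (q ^ 2)⁻¹ := by rw [Real.rpow_neg hT0.le, ← hK, hKq]
  have hn0 : (0 : ℝ) < n := by exact_mod_cast hn
  have hN : 0 < n * M := mul_pos hn0 hM
  have key : ∀ c : ℝ, 0 < c → c * (T : ℝ) ^ (-(1 / 4) : ℝ) / r ≤ 1 →
      BlockBandit.LossBounds T S r R G M (c * (T : ℝ) ^ (-(1 / 4) : ℝ)) f := fun c hc hcr =>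
    { r_pos := hr
      δ_pos := by positivity
      δ_le := (div_le_one hr).1 hcr
      R_pos := hR
      G_pos := hG
      M_pos := hM
      convex_set := hS_convex
      compact_set := hS_compact
      ball_subset := hrS
      subset_ball := hSR
      convex_loss := hf_convex
      lipschitz_loss := fun t ht a ha b hb =>
        BlockBandit.abs_sub_le_of_subdifferential_bounded (hf_convex t ht) (hf_subgrad t ht) ha hb
      bound_loss := hf_bound }
  refine ⟨fun c hc hcr A => ?_, fun hTc c hcdef A => ?_⟩
  · obtain ⟨h1, h2, h3, -⟩ := A.bounds_of_parameters (key c hc hcr) hq1 hc hKq hTK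
      (by rw [hm34]) (by rw [hm14]) (by rw [hm12])
    refine ⟨h1, by rwa [h34], h3.trans (ENNReal.ofReal_le_ofReal ?_)⟩
    refine mul_le_mul_of_nonneg_right ?_ hT0.le
    have h4 : G * c / (2 * n * M) = G * c / (n * M) / 2 := by field_simp
    have h5 : G ^ 2 * c ^ 2 / (4 * n ^ 2 * M ^ 2) = (G * c / (n * M)) ^ 2 / 4 := by
      field_simp
    rw [h4, h5]
    linarith [sq_nonneg (G * c / (n * M))]
  · have hc2 : c ^ 2 = n * M * r / G := by rw [hcdef]; exact Real.sq_sqrt (by positivity)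
    have hc : 0 < c := by rw [hcdef]; exact Real.sqrt_pos.2 (by positivity)
    have hcr : c * (T : ℝ) ^ (-(1 / 4) : ℝ) / r ≤ 1 := by
      -- The lower bound on `T` is what makes `δ ≤ r`, that is `c² ≤ (q r)²`.
      have h1 : n * M / (G * r) ≤ q ^ 2 := by
        refine abs_le_of_sq_le_sq' ?_ (by positivity) |>.2
        rw [← hKq, sq (K : ℝ), ← Nat.cast_mul, ← hTK]
        exact hTc
      have h2 : c ^ 2 ≤ (q * r) ^ 2 := by
        rw [hc2, mul_pow]
        calc n * M * r / G = n * M / (G * r) * r ^ 2 := by field_simp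
          _ ≤ q ^ 2 * r ^ 2 := by gcongr
      have h3 : c ≤ q * r := (abs_le_of_sq_le_sq' h2 (by positivity)).2
      rw [hm14, div_le_one hr, ← div_eq_mul_inv, div_le_iff₀ hq0]
      linarith
    obtain ⟨h1, h2, h3, h4⟩ := A.bounds_of_parameters (key c hc hcr) hq1 hc hKq hTK
      (by rw [hm34]) (by rw [hm14]) (by rw [hm12])
    set a := √(G * r / (n * M)) with ha
    have haG : G * c / (n * M) = a := by
      rw [ha, eq_comm, Real.sqrt_eq_iff_eq_sq (by positivity) (by positivity), div_pow, mul_pow, hc2]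
      field_simp
    have ha0 : 0 < a := Real.sqrt_pos.2 (by positivity)
    refine ⟨h1, ?_, ?_⟩
    · rw [h34]
      refine h2.trans (mul_le_mul_of_nonneg_right ?_ (by positivity))
      -- Needed to absorb `3cG` into `3 (R/r) cG`, which gives `3 + 1 + 4 = 8`; since `1 ≤ n`, the
      -- ball contains a point of norm `r`.
      have hrR : r ≤ R := by
        have : Nonempty (Fin n) := ⟨⟨0, hn⟩⟩
        obtain ⟨p, hp⟩ := exists_norm_eq (BlockBandit.E n) hr.le
        have h5 := hSR (hrS (mem_closedBall_zero_iff.2 hp.le))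
        rw [mem_closedBall_zero_iff, hp] at h5
        exact h5
      have hs1 : √(n * M * r * G) = c * G := by
        rw [Real.sqrt_eq_iff_eq_sq (by positivity) (by positivity), mul_pow, hc2]
        field_simp
      have hs2 : √(r * G / (n * M)) = G * c / (n * M) := by rw [haG, ha, mul_comm r G]
      rw [hs1, hs2]
      have h5 : R * n * M / c = R / r * (c * G) := by
        have : c * c = n * M * r / G := by rw [← sq, hc2]
        rw [div_eq_iff hc.ne']
        calc R * n * M = R / r * G * (n * M * r / G) := by field_simp
          _ = R / r * (c * G) * c := by rw [← this]; ring
      have h6 : 1 ≤ R / r := (one_le_div hr).2 hrR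
      have h7 : c * G ≤ R / r * (c * G) := le_mul_of_one_le_left (by positivity) h6
      have h8 : c * R * G / r = R / r * (c * G) := by field_simp
      have h9 : c * G ^ 2 * R / (n * M) = G * R * (G * c / (n * M)) := by field_simp
      rw [h5, h8, h9]
      linarith
    · rw [haG] at h3
      -- The last term of the claimed bound is linear in `a`, whereas the general bound gives
      -- `a²/16`. This is at most `a/4` when `a ≤ 4`; for larger `a` the claim exceeds the worst
      -- case `2T`.
      rcases le_total a 4 with h5 | h5
      · refine h3.trans (ENNReal.ofReal_le_ofReal (mul_le_mul_of_nonneg_right ?_ hT0.le))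
        nlinarith
      · refine h4.trans (ENNReal.ofReal_le_ofReal (mul_le_mul_of_nonneg_right ?_ hT0.le))
        linarith
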